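/- Let $d,m\ge 0$ be integers, $\Psi_0\in\mathbb R^{m\times(d+m)}$, $\Psi_1\in\mathbb R^{d\times(d+m)}$, $\alpha,\mu^0\in\mathbb R^d$, $\eta\in\mathbb R^m$, $r\in\mathbb R$, $\delta=\mathrm{diag}(\delta^1,\dots,\delta^d)$ with all $\delta^i>0$, and $\gamma<0$. Put $$\Sigma_0=\Psi_0\Psi_0^\top,\quad \Sigma_1=\Psi_1\Psi_1^\top,\quad \beta=\Psi_1\Psi_0^\top\Sigma_0^{-1},\quad \Sigma_2=\Sigma_1-\Psi_1\Psi_0^\top\beta^\top,$$ $$\Sigma_3=\Sigma_1-\Psi_1\Psi_0^\top\beta^\top-\beta\Psi_0\Psi_1^\top+\beta\Sigma_0\beta^\top,\qquad \Sigma_c=\Sigma_1^{-1}\beta(\beta^\top\Sigma_1^{-1}\beta)^{-1}\beta^\top\Sigma_1^{-1},$$ $\mu=(\mu^{0,i}-r)_{i}\in\mathbb R^d$ and $\theta^i=(-\alpha^i-\sum_j\beta^{ij}\eta^j+\mu^{0,i})/\delta^i$. Assume that $\Sigma_0$ and $\Sigma_1$ are positive definite and that $\mathrm{rank}(\beta^\top\beta)=m$.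 Let $T\in\mathbb R$ and consider on $(-\infty,T]$ the system of the market-neutral ($\pi^\top\beta=0$) power-utility portfolio problem, consisting of the matrix Riccati equation $$\begin{aligned}\frac{dC}{dt}={}&-C\Big(\tfrac{2\gamma}{1-\gamma}\Sigma_2^\top(\Sigma_1^{-1}-\Sigma_c)\Sigma_2+2\Sigma_3\Big)C+C\Big(\tfrac{\gamma}{1-\gamma}\Sigma_2^\top(\Sigma_1^{-1}-\Sigma_c)\delta+\delta\Big)\\&+\Big(\tfrac{\gamma}{1-\gamma}\Sigma_2^\top(\Sigma_1^{-1}-\Sigma_c)\delta+\delta\Big)^{\top}C-\tfrac{\gamma}{2(1-\gamma)}\delta(\Sigma_1^{-1}-\Sigma_c)\delta,\qquad C(T)=0,\end{aligned}$$ and the linear equation $$\frac{db}{dt}=R_c(t)\,b-C(t)\Big(\tfrac{2\gamma}{1-\gamma}\Sigma_2^\top(\Sigma_1^{-1}-\Sigma_c)\mu+2\delta\theta\Big)+\tfrac{\gamma}{1-\gamma}\delta(\Sigma_1^{-1}-\Sigma_c)\mu,\qquad b(T)=0,$$ where $$R_c(t)=-C(t)\Big(\tfrac{2\gamma}{1-\gamma}\Sigma_2^\top(\Sigma_1^{-1}-\Sigma_c)\Sigma_2+2\Sigma_3\Big)+\tfrac{\gamma}{1-\gamma}\delta(\Sigma_1^{-1}-\Sigma_c)\Sigma_2+\delta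 .$$ This system has a unique solution $(C,b)$ on $(-\infty,T]$. There exists a finite $t^*\le T$ such that for every $t<t^*$ all (complex) eigenvalues of $R_c(t)$ have positive real part. Moreover $b(t)$ has a finite steady state: the limit $\bar b=\lim_{t\to-\infty}b(t)$ exists in $\mathbb R^d$. -/

import Mathlib

open Filter Topology Set Matrix

/-- Parameters of the co-integration model with `d` stocks and `m` factors driven by `d + m`
independent Brownian motions, together with the exponent of the power utility `w ^ γ / γ`. -/
structure CointegrationModel (d m : ℕ) where
  /-- Factor diffusion loadings. -/
  psi0 : Matrix (Fin m) (Fin (d + m)) ℝ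
  /-- Stock diffusion loadings. -/
  psi1 : Matrix (Fin d) (Fin (d + m)) ℝ
  /-- Systemic stock returns after controlling for the factors. -/
  alpha : Fin d → ℝ
  /-- Factor drifts. -/
  eta : Fin m → ℝ
  /-- Stock drifts. -/
  mu : Fin d → ℝ
  /-- Mean-reversion speeds of the spreads. -/
  delta : Fin d → ℝ
  /-- Risk-free interest rate. -/
  r : ℝ
  /-- Risk-aversion coefficient of the utility. -/
  gamma : ℝ

namespace CointegrationModel

variable {d m : ℕ} (p : CointegrationModel d m)

/-- Diffusion matrix of the factors. -/
noncomputable def sigma0 : Matrix (Fin m) (Fin m) ℝ := p.psi0 * p.psi0ᵀ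

/-- Diffusion matrix of the stocks. -/
noncomputable def sigma1 : Matrix (Fin d) (Fin d) ℝ := p.psi1 * p.psi1ᵀ

/-- Factor loadings of the stocks. -/
noncomputable def beta : Matrix (Fin d) (Fin m) ℝ := p.psi1 * p.psi0ᵀ * p.sigma0⁻¹

/-- Instantaneous covariance of the stock returns with the spreads. -/
noncomputable def sigma2 : Matrix (Fin d) (Fin d) ℝ :=
  p.sigma1 - p.psi1 * p.psi0ᵀ * p.betaᵀ

/-- Diffusion matrix of the spreads. -/
noncomputable def sigma3 : Matrix (Fin d) (Fin d) ℝ :=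
  p.sigma1 - p.psi1 * p.psi0ᵀ * p.betaᵀ - p.beta * p.psi0 * p.psi1ᵀ
    + p.beta * p.sigma0 * p.betaᵀ

/-- The matrix which the constraint `πᵀ β = 0` subtracts from `Σ₁⁻¹`. -/
noncomputable def sigmaC : Matrix (Fin d) (Fin d) ℝ :=
  p.sigma1⁻¹ * p.beta * (p.betaᵀ * p.sigma1⁻¹ * p.beta)⁻¹ * p.betaᵀ * p.sigma1⁻¹

/-- Diagonal matrix of the mean-reversion speeds. -/
noncomputable def deltaMat : Matrix (Fin d) (Fin d) ℝ := Matrix.diagonal p.delta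

/-- Stationary means of the spreads. -/
noncomputable def theta : Fin d → ℝ :=
  fun i => (-p.alpha i - ∑ j, p.beta i j * p.eta j + p.mu i) / p.delta i

/-- Excess drifts `μ - r` of the stocks. -/
noncomputable def muExcess : Fin d → ℝ := fun i => p.mu i - p.r

/-- Right-hand side of the matrix Riccati equation for `C`, as a function of the value of `C`. -/
noncomputable def riccatiRHS (C : Matrix (Fin d) (Fin d) ℝ) : Matrix (Fin d) (Fin d) ℝ :=
  -(C * ((2 * p.gamma / (1 - p.gamma)) • (p.sigma2ᵀ * (p.sigma1⁻¹ - p.sigmaC) * p.sigma2)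
        + (2 : ℝ) • p.sigma3) * C)
    + C * ((p.gamma / (1 - p.gamma)) • (p.sigma2ᵀ * (p.sigma1⁻¹ - p.sigmaC) * p.deltaMat)
        + p.deltaMat)
    + ((p.gamma / (1 - p.gamma)) • (p.sigma2ᵀ * (p.sigma1⁻¹ - p.sigmaC) * p.deltaMat)
        + p.deltaMat)ᵀ * C
    - (p.gamma / (2 * (1 - p.gamma))) •
        (p.deltaMat * (p.sigma1⁻¹ - p.sigmaC) * p.deltaMat)

/-- Coefficient matrix `R_c` of the homogeneous part of the equation for `b`, as a function of the
value of `C`. -/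
noncomputable def Rc (C : Matrix (Fin d) (Fin d) ℝ) : Matrix (Fin d) (Fin d) ℝ :=
  -(C * ((2 * p.gamma / (1 - p.gamma)) • (p.sigma2ᵀ * (p.sigma1⁻¹ - p.sigmaC) * p.sigma2)
        + (2 : ℝ) • p.sigma3))
    + ((p.gamma / (1 - p.gamma)) • (p.deltaMat * (p.sigma1⁻¹ - p.sigmaC) * p.sigma2)
        + p.deltaMat)

/-- Inhomogeneous term of the equation for `b`, as a function of the value of `C`. -/
noncomputable def forcing (C : Matrix (Fin d) (Fin d) ℝ) : Fin d → ℝ :=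
  -(C *ᵥ ((2 * p.gamma / (1 - p.gamma)) •
          ((p.sigma2ᵀ * (p.sigma1⁻¹ - p.sigmaC)) *ᵥ p.muExcess)
        + (2 : ℝ) • (p.deltaMat *ᵥ p.theta)))
    + (p.gamma / (1 - p.gamma)) •
        ((p.deltaMat * (p.sigma1⁻¹ - p.sigmaC)) *ᵥ p.muExcess)

/-- `C` and `b` solve, on `(-∞, T]`, the matrix Riccati equation and the linear equation of the
market-neutral problem, with zero terminal values at `T`. Only the values on `(-∞, T]` matter;
the derivative at `T` is the one-sided one. -/
structure IsSolution (T : ℝ) (C : ℝ → Matrix (Fin d) (Fin d) ℝ) (b : ℝ → Fin d → ℝ) : Prop where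
  terminal_C : C T = 0
  terminal_b : b T = 0
  deriv_C : ∀ t ≤ T, ∀ i j,
    HasDerivWithinAt (fun s => C s i j) (p.riccatiRHS (C t) i j) (Iic T) t
  deriv_b : ∀ t ≤ T, ∀ i,
    HasDerivWithinAt (fun s => b s i) ((p.Rc (C t) *ᵥ b t + p.forcing (C t)) i) (Iic T) t

end CointegrationModel

/-! ### Scalar differential inequalities and limits of derivatives. -/

section ScalarComparison

/-! Reverse time and put `P s = -C (T - s)`. Write `S = Σ₃` (which equals `Σ₂`), `M = Σ₁⁻¹ - Σ_c`,
`D = δ` and `κ = γ / (1 - γ)`, so that `-1 < κ < 0`. The Riccati equation becomes `P' = K - AᵀP - PA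
- PQP` with `P 0 = 0`, `A = D + κ S M D`, `Q = 2κ S M S + 2S`, `K = -(κ/2) D M D`, and `R_c = (A +
QP)ᵀ`. The market-neutral constraint enters through `M β = 0`, whence `M S M = M`; this makes `Q`
positive semidefinite, and `K` is so because `κ < 0`.

Global existence comes from the Hamiltonian linear system: `P = Y X⁻¹`, where `X` stays invertible,
`P ≥ 0` and `P' ≥ 0` (`exists_riccati_solution`). An explicit gain `L` with `A + QL = D` bounds the
trace of `P` (`trace_riccatiField_le`), so the increasing `P` converges to a root of the algebraic
Riccati equation.

No observability is available to make the limit definite. Instead `P + ε I` is a strict Lyapunov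
matrix for the limiting closed loop, by completing two squares and using `D > 0`
(`exists_lyapunov_of_riccatiField_eq_zero`). Its inverse is a quadratic norm in which `R_c` is
uniformly dissipative for all large `s`. This gives both the eigenvalue claim
(`re_pos_of_dissipative`) and the convergence of `b` (`exists_tendsto_of_dissipative`). Uniqueness
is local Lipschitz continuity of a polynomial vector field. -/

theorem le_of_hasDerivAt_le_neg_mul_add {U U' : ℝ → ℝ} {a w s₀ : ℝ} (ha : 0 < a)
    (hU : ∀ s, s₀ ≤ s → HasDerivAt U (U' s) s) (hle : ∀ s, s₀ ≤ s → U' s ≤ -a * U s + w)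
    {s : ℝ} (hs : s₀ ≤ s) :
    U s ≤ w / a + (U s₀ - w / a) * Real.exp (-(a * (s - s₀))) := by
  have hderiv : ∀ s, s₀ ≤ s → HasDerivAt (fun s => (U s - w / a) * Real.exp (a * (s - s₀)))
      ((U' s + a * U s - w) * Real.exp (a * (s - s₀))) s := by
    intro s hs
    have h1 : HasDerivAt (fun s : ℝ => a * (s - s₀)) (a * 1) s :=
      ((hasDerivAt_id s).sub_const s₀).const_mul a
    convert! ((hU s hs).sub_const (w / a)).mul h1.exp using 1
    field_simp
    ring
  have hanti : AntitoneOn (fun s => (U s - w / a) * Real.exp (a * (s - s₀))) (Ici s₀) := by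
    refine antitoneOn_of_hasDerivWithinAt_nonpos (convex_Ici s₀)
      (fun s hs => (hderiv s hs).continuousAt.continuousWithinAt)
      (fun s hs => (hderiv s (interior_subset hs)).hasDerivWithinAt) ?_
    intro s hs
    have := hle s (interior_subset hs)
    exact mul_nonpos_of_nonpos_of_nonneg (by linarith) (Real.exp_pos _).le
  have h := hanti (mem_Ici.2 le_rfl) (mem_Ici.2 hs) hs
  simp only [sub_self, mul_zero, Real.exp_zero, mul_one] at h
  have h2 := mul_le_mul_of_nonneg_right h (Real.exp_pos (-(a * (s - s₀)))).le
  rw [mul_assoc, ← Real.exp_add, add_neg_cancel, Real.exp_zero, mul_one] at h2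
  linarith

theorem tendsto_zero_of_hasDerivAt_le_neg_mul_add {U U' h : ℝ → ℝ} {a s₀ : ℝ} (ha : 0 < a)
    (hnn : ∀ s, s₀ ≤ s → 0 ≤ U s)
    (hU : ∀ s, s₀ ≤ s → HasDerivAt U (U' s) s)
    (hle : ∀ s, s₀ ≤ s → U' s ≤ -a * U s + h s)
    (hh : Tendsto h atTop (𝓝 0)) : Tendsto U atTop (𝓝 0) := by
  rw [Metric.tendsto_atTop]
  intro ε hε
  have hlim : ∀ᶠ s in atTop, h s < a * (ε / 2) := hh.eventually (gt_mem_nhds (by positivity))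
  obtain ⟨s₁, hs₁⟩ := eventually_atTop.1 hlim
  set σ := max s₀ s₁
  have hexp : Tendsto (fun s => (U σ - a * (ε / 2) / a) * Real.exp (-(a * (s - σ)))) atTop
      (𝓝 ((U σ - a * (ε / 2) / a) * 0)) := by
    refine Tendsto.const_mul _ (Real.tendsto_exp_neg_atTop_nhds_zero.comp ?_)
    exact (tendsto_atTop_add_const_right _ (-σ) tendsto_id).const_mul_atTop ha
  rw [mul_zero] at hexp
  obtain ⟨s₂, hs₂⟩ := eventually_atTop.1 (hexp.eventually (gt_mem_nhds (half_pos hε)))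
  refine ⟨max σ s₂, fun s hs => ?_⟩
  have hσ : σ ≤ s := (le_max_left _ _).trans hs
  have h1 := le_of_hasDerivAt_le_neg_mul_add (w := a * (ε / 2)) ha
    (fun s hs => hU s ((le_max_left _ _).trans hs))
    (fun s hs => (hle s ((le_max_left _ _).trans hs)).trans
      (by linarith [hs₁ s ((le_max_right _ _).trans hs)])) hσ
  have h2 := hs₂ s ((le_max_right _ _).trans hs)
  have h3 := hnn s ((le_max_left _ _).trans hσ)
  have h4 : a * (ε / 2) / a = ε / 2 := by field_simp
  rw [Real.dist_eq, sub_zero, abs_of_nonneg h3]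
  rw [h4] at h1 h2
  linarith

/-- By the mean value theorem on `[s, s + 1]`, the derivative takes the value `f (s + 1) - f s → 0`
at arbitrarily late times. This is what turns the limit of `P` into a stationary point. -/
theorem eq_zero_of_tendsto_of_hasDerivAt_tendsto {f f' : ℝ → ℝ} {s₀ l l' : ℝ}
    (hf : ∀ s, s₀ ≤ s → HasDerivAt f (f' s) s) (hl : Tendsto f atTop (𝓝 l))
    (hl' : Tendsto f' atTop (𝓝 l')) : l' = 0 := by
  have hstep : ∀ s : ℝ, ∃ c : ℝ, s ≤ c ∧ (s₀ ≤ s → f' c = f (s + 1) - f s) := by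
    intro s
    by_cases hs : s₀ ≤ s
    · obtain ⟨c, hc, hc'⟩ := exists_hasDerivAt_eq_slope f f' (lt_add_one s)
        (fun x hx => (hf x (hs.trans hx.1)).continuousAt.continuousWithinAt)
        (fun x hx => hf x (hs.trans hx.1.le))
      exact ⟨c, hc.1.le, fun _ => by rw [hc']; simp⟩
    · exact ⟨s, le_rfl, fun h => absurd h hs⟩
  choose c hc hc' using hstep
  have h1 : Tendsto (fun s => f' (c s)) atTop (𝓝 l') :=
    hl'.comp (tendsto_atTop_mono hc tendsto_id)
  have h2 : Tendsto (fun s => f (s + 1) - f s) atTop (𝓝 (l - l)) :=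
    (hl.comp (tendsto_atTop_add_const_right _ 1 tendsto_id)).sub hl
  rw [sub_self] at h2
  refine tendsto_nhds_unique (h1.congr' ?_) h2
  filter_upwards [eventually_ge_atTop s₀] with s hs using hc' s hs

end ScalarComparison

/-! ### Elementary bounds for quadratic forms. -/

section QuadraticForms

variable {n : Type*} [Fintype n]

theorem Matrix.abs_dotProduct_mulVec_le (B : Matrix n n ℝ) (x y : n → ℝ) :
    |x ⬝ᵥ B *ᵥ y| ≤ (∑ i, ∑ j, |B i j|) * ((x ⬝ᵥ x + y ⬝ᵥ y) / 2) := by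
  simp only [dotProduct, mulVec, Finset.mul_sum]
  refine (Finset.abs_sum_le_sum_abs _ _).trans ?_
  rw [Finset.sum_mul]
  refine Finset.sum_le_sum fun i _ => (Finset.abs_sum_le_sum_abs _ _).trans ?_
  rw [Finset.sum_mul]
  refine Finset.sum_le_sum fun j _ => ?_
  have hx : x i * x i ≤ ∑ i, x i * x i :=
    Finset.single_le_sum (fun i _ => mul_self_nonneg (x i)) (Finset.mem_univ i)
  have hy : y j * y j ≤ ∑ i, y i * y i :=
    Finset.single_le_sum (fun i _ => mul_self_nonneg (y i)) (Finset.mem_univ j)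
  rw [show x i * (B i j * y j) = B i j * (x i * y j) by ring, abs_mul]
  refine mul_le_mul_of_nonneg_left ?_ (abs_nonneg _)
  rw [abs_le]
  constructor <;> nlinarith [sq_nonneg (x i + y j), sq_nonneg (x i - y j)]

theorem Matrix.dotProduct_mulVec_self_le (B : Matrix n n ℝ) (x : n → ℝ) :
    |x ⬝ᵥ B *ᵥ x| ≤ (∑ i, ∑ j, |B i j|) * (x ⬝ᵥ x) := by
  have := Matrix.abs_dotProduct_mulVec_le B x x
  rwa [add_self_div_two] at this

theorem Matrix.dotProduct_mulVec_comm_of_transpose_eq {B : Matrix n n ℝ} (hB : Bᵀ = B)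
    (x y : n → ℝ) : x ⬝ᵥ B *ᵥ y = y ⬝ᵥ B *ᵥ x := by
  rw [dotProduct_mulVec, ← mulVec_transpose, hB, dotProduct_comm]

theorem Matrix.PosSemidef.transpose_eq {n : Type*} {B : Matrix n n ℝ} (hB : B.PosSemidef) :
    Bᵀ = B := by
  have := hB.isHermitian.eq
  rwa [conjTranspose_eq_transpose_of_trivial] at this

theorem Matrix.PosSemidef.dotProduct_mulVec_self_nonneg {B : Matrix n n ℝ} (hB : B.PosSemidef)
    (x : n → ℝ) :
    0 ≤ x ⬝ᵥ B *ᵥ x := by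
  simpa using hB.dotProduct_mulVec_nonneg x

theorem Matrix.posSemidef_of_transpose_eq {B : Matrix n n ℝ} (hB : Bᵀ = B)
    (h : ∀ x : n → ℝ, 0 ≤ x ⬝ᵥ B *ᵥ x) : B.PosSemidef := by
  refine .of_dotProduct_mulVec_nonneg ?_ fun x => by simpa using h x
  rw [IsHermitian, conjTranspose_eq_transpose_of_trivial, hB]

theorem exists_pos_forall_le {n : Type*} [Finite n] {δ : n → ℝ} (hδ : ∀ i, 0 < δ i) :
    ∃ c > 0, ∀ i, c ≤ δ i := by
  cases isEmpty_or_nonempty n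
  · exact ⟨1, one_pos, fun i => isEmptyElim i⟩
  · obtain ⟨i, hi⟩ := Finite.exists_min δ
    exact ⟨δ i, hδ i, hi⟩

theorem hasDerivAt_dotProduct {x y : ℝ → n → ℝ} {x' y' : n → ℝ} {s : ℝ}
    (hx : HasDerivAt x x' s) (hy : HasDerivAt y y' s) :
    HasDerivAt (fun s => x s ⬝ᵥ y s) (x' ⬝ᵥ y s + x s ⬝ᵥ y') s := by
  rw [hasDerivAt_pi] at hx hy
  simp only [dotProduct, ← Finset.sum_add_distrib]
  exact HasDerivAt.fun_sum fun i _ => (hx i).mul (hy i)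

end QuadraticForms

/-! ### Product and inverse rules for matrix-valued functions. -/

section MatrixDeriv
open scoped Matrix.Norms.Operator

variable {n : Type*} [Fintype n]

theorem hasDerivAt_matrix_iff {n m : Type*} [Fintype n] [Fintype m] {F : ℝ → Matrix n m ℝ}
    {F' : Matrix n m ℝ} {s : ℝ} :
    HasDerivAt F F' s ↔ ∀ i j, HasDerivAt (fun s => F s i j) (F' i j) s :=
  hasDerivAt_pi.trans (forall_congr' fun _ => hasDerivAt_pi)

theorem HasDerivAt.matrix_transpose {F : ℝ → Matrix n n ℝ} {F' : Matrix n n ℝ} {s : ℝ}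
    (h : HasDerivAt F F' s) : HasDerivAt (fun s => (F s)ᵀ) F'ᵀ s :=
  hasDerivAt_matrix_iff.2 fun i j => hasDerivAt_matrix_iff.1 h j i

theorem HasDerivAt.matrix_mulVec {F : ℝ → Matrix n n ℝ} {F' : Matrix n n ℝ} {s : ℝ}
    {v : ℝ → n → ℝ} {v' : n → ℝ}
    (h : HasDerivAt F F' s) (hv : HasDerivAt v v' s) :
    HasDerivAt (fun s => F s *ᵥ v s) (F' *ᵥ v s + F s *ᵥ v') s := by
  rw [hasDerivAt_pi]
  intro i
  exact hasDerivAt_dotProduct (hasDerivAt_pi.1 h i) hv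

theorem HasDerivAt.const_mulVec {s : ℝ} {v : ℝ → n → ℝ} {v' : n → ℝ} (hv : HasDerivAt v v' s)
    (B : Matrix n n ℝ) : HasDerivAt (fun s => B *ᵥ v s) (B *ᵥ v') s := by
  rw [hasDerivAt_pi]
  intro i
  have := hasDerivAt_dotProduct (hasDerivAt_const s (B i)) hv
  rwa [zero_dotProduct, zero_add] at this

theorem HasDerivAt.matrix_mul {F G : ℝ → Matrix n n ℝ} {F' G' : Matrix n n ℝ} {s : ℝ}
    (hF : HasDerivAt F F' s) (hG : HasDerivAt G G' s) :
    HasDerivAt (fun s => F s * G s) (F' * G s + F s * G') s := by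
  rw [hasDerivAt_matrix_iff] at *
  intro i j
  exact hasDerivAt_dotProduct (hasDerivAt_pi.2 (hF i)) (hasDerivAt_pi.2 fun k => hG k j)

theorem HasDerivAt.matrix_inv [DecidableEq n] {F : ℝ → Matrix n n ℝ} {F' : Matrix n n ℝ} {s : ℝ}
    (h : HasDerivAt F F' s) (hu : IsUnit (F s)) :
    HasDerivAt (fun s => (F s)⁻¹) (-((F s)⁻¹ * F' * (F s)⁻¹)) s := by
  obtain ⟨u, hu⟩ := hu
  have h1 := hasFDerivAt_ringInverse (𝕜 := ℝ) u
  rw [hu] at h1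
  have h2 := h1.comp_hasDerivAt s h
  have h3 : ((u⁻¹ : (Matrix n n ℝ)ˣ) : Matrix n n ℝ) = (F s)⁻¹ := by
    rw [← hu, Matrix.coe_units_inv]
  simp only [Matrix.nonsing_inv_eq_ringInverse] at h3 ⊢
  simp only [h3, _root_.neg_apply, ContinuousLinearMap.mulLeftRight_apply] at h2
  exact h2

end MatrixDeriv

/-! ### Solving the Riccati equation through its Hamiltonian system. -/

section Hamiltonian

variable {n : Type*} [Fintype n]

/-- The vector field of the Riccati equation `P' = K - Aᵀ P - P A - P Q P`. -/
def riccatiField (A Q K P : Matrix n n ℝ) : Matrix n n ℝ := K - Aᵀ * P - P * A - P * Q * P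

theorem riccatiField_transpose {A Q K P : Matrix n n ℝ} (hQ : Qᵀ = Q) (hK : Kᵀ = K)
    (hP : Pᵀ = P) : (riccatiField A Q K P)ᵀ = riccatiField A Q K P := by
  simp only [riccatiField, transpose_sub, transpose_mul, hP, transpose_transpose, hQ, hK,
    Matrix.mul_assoc]
  abel

/-- `(x, y)` solves the Hamiltonian system `x' = A x + Q y`, `y' = K x - Aᵀ y`. -/
structure IsHamiltonianFlow (A Q K : Matrix n n ℝ) (x y : ℝ → n → ℝ) : Prop where
  deriv_fst : ∀ s, HasDerivAt x (A *ᵥ x s + Q *ᵥ y s) s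
  deriv_snd : ∀ s, HasDerivAt y (K *ᵥ x s - Aᵀ *ᵥ y s) s

section Exp
open scoped Matrix.Norms.Operator

theorem exists_fundamental_matrix {m : Type*} [Fintype m] [DecidableEq m] (H : Matrix m m ℝ) :
    ∃ Z : ℝ → Matrix m m ℝ, Z 0 = 1 ∧ ∀ s, HasDerivAt Z (H * Z s) s := by
  refine ⟨fun s => NormedSpace.exp (s • H), by simp, fun s => ?_⟩
  exact hasDerivAt_exp_smul_const' H s

end Exp

theorem exists_hamiltonian_fundamental [DecidableEq n] (A Q K : Matrix n n ℝ) :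
    ∃ X Y : ℝ → Matrix n n ℝ, X 0 = 1 ∧ Y 0 = 0 ∧
      (∀ s, HasDerivAt X (A * X s + Q * Y s) s) ∧
      (∀ s, HasDerivAt Y (K * X s - Aᵀ * Y s) s) := by
  obtain ⟨Z, hZ0, hZ⟩ := exists_fundamental_matrix (fromBlocks A Q K (-Aᵀ))
  refine ⟨fun s => (Z s).toBlocks₁₁, fun s => (Z s).toBlocks₂₁, ?_, ?_, fun s => ?_, fun s => ?_⟩
  · simp only [hZ0]
    rw [← fromBlocks_one, toBlocks_fromBlocks₁₁]
  · simp only [hZ0]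
    rw [← fromBlocks_one, toBlocks_fromBlocks₂₁]
  · rw [hasDerivAt_matrix_iff]
    intro i j
    convert! hasDerivAt_matrix_iff.1 (hZ s) (Sum.inl i) (Sum.inl j) using 1
    simp [mul_apply, toBlocks₁₁, toBlocks₂₁]
  · rw [hasDerivAt_matrix_iff]
    intro i j
    convert! hasDerivAt_matrix_iff.1 (hZ s) (Sum.inr i) (Sum.inl j) using 1
    simp [mul_apply, toBlocks₁₁, toBlocks₂₁, sub_eq_add_neg]

namespace IsHamiltonianFlow

variable {A Q K : Matrix n n ℝ} {x y x₂ y₂ : ℝ → n → ℝ}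

theorem deriv_flow (h : IsHamiltonianFlow A Q K x y) :
    IsHamiltonianFlow A Q K (fun s => A *ᵥ x s + Q *ᵥ y s) (fun s => K *ᵥ x s - Aᵀ *ᵥ y s) where
  deriv_fst s := (HasDerivAt.const_mulVec (h.deriv_fst s) A).add
    (HasDerivAt.const_mulVec (h.deriv_snd s) Q)
  deriv_snd s := (HasDerivAt.const_mulVec (h.deriv_fst s) K).sub
    (HasDerivAt.const_mulVec (h.deriv_snd s) Aᵀ)

/-- The flow is symplectic: with `Q` and `K` symmetric, all terms in the derivative of the
symplectic pairing cancel. -/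
theorem dotProduct_sub_dotProduct_eq (hQ : Q.PosSemidef) (hK : K.PosSemidef)
    (h : IsHamiltonianFlow A Q K x y) (h₂ : IsHamiltonianFlow A Q K x₂ y₂) (s : ℝ) :
    x s ⬝ᵥ y₂ s - y s ⬝ᵥ x₂ s = x 0 ⬝ᵥ y₂ 0 - y 0 ⬝ᵥ x₂ 0 := by
  have hd : ∀ s, HasDerivAt (fun s => x s ⬝ᵥ y₂ s - y s ⬝ᵥ x₂ s) 0 s := by
    intro s
    convert! (hasDerivAt_dotProduct (h.deriv_fst s) (h₂.deriv_snd s)).sub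
      (hasDerivAt_dotProduct (h.deriv_snd s) (h₂.deriv_fst s)) using 1
    have h1 : (A *ᵥ x s) ⬝ᵥ y₂ s = x s ⬝ᵥ Aᵀ *ᵥ y₂ s := by
      rw [dotProduct_mulVec, vecMul_transpose]
    have h2 : y s ⬝ᵥ A *ᵥ x₂ s = (Aᵀ *ᵥ y s) ⬝ᵥ x₂ s := by
      rw [dotProduct_mulVec, mulVec_transpose]
    have h3 := dotProduct_mulVec_comm_of_transpose_eq hQ.transpose_eq (y s) (y₂ s)
    have h4 := dotProduct_mulVec_comm_of_transpose_eq hK.transpose_eq (x s) (x₂ s)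
    simp only [add_dotProduct, dotProduct_add, sub_dotProduct, dotProduct_sub]
    rw [dotProduct_comm (Q *ᵥ y s), dotProduct_comm (K *ᵥ x s)]
    linarith
  exact is_const_of_deriv_eq_zero (fun s => (hd s).differentiableAt) (fun s => (hd s).deriv) s 0

theorem hasDerivAt_dotProduct_self (h : IsHamiltonianFlow A Q K x y) (s : ℝ) :
    HasDerivAt (fun s => x s ⬝ᵥ y s) (x s ⬝ᵥ K *ᵥ x s + y s ⬝ᵥ Q *ᵥ y s) s := by
  convert! hasDerivAt_dotProduct (h.deriv_fst s) (h.deriv_snd s) using 1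
  have h1 : (A *ᵥ x s) ⬝ᵥ y s = x s ⬝ᵥ Aᵀ *ᵥ y s := by
    rw [dotProduct_mulVec, vecMul_transpose]
  simp only [add_dotProduct, dotProduct_sub]
  rw [dotProduct_comm (Q *ᵥ y s)]
  linarith

theorem monotone_dotProduct (hQ : Q.PosSemidef) (hK : K.PosSemidef)
    (h : IsHamiltonianFlow A Q K x y) : Monotone fun s => x s ⬝ᵥ y s :=
  monotone_of_hasDerivAt_nonneg h.hasDerivAt_dotProduct_self fun _ =>
    add_nonneg (hK.dotProduct_mulVec_self_nonneg _) (hQ.dotProduct_mulVec_self_nonneg _)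

/-- If `x s = 0`, the monotone quantity `x ⬝ᵥ y` vanishes at both ends of `[0, s]`, hence
throughout. Its derivative then forces `Q y = 0`, so `x' = A x` there, and a solution of that
equation cannot reach zero from a nonzero value. -/
theorem fst_ne_zero (hQ : Q.PosSemidef) (hK : K.PosSemidef) (h : IsHamiltonianFlow A Q K x y)
    (hy : y 0 = 0) (hx : x 0 ≠ 0) {s : ℝ} (hs : 0 ≤ s) : x s ≠ 0 := by
  intro hxs
  have hmono := h.monotone_dotProduct hQ hK
  have hzero : ∀ τ ∈ Icc 0 s, x τ ⬝ᵥ y τ = 0 := by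
    intro τ hτ
    have h1 := hmono hτ.1
    have h2 := hmono hτ.2
    simp only [hy, hxs, dotProduct_zero, zero_dotProduct] at h1 h2
    exact le_antisymm h2 h1
  have hQy : ∀ τ ∈ Ioo 0 s, Q *ᵥ y τ = 0 := by
    intro τ hτ
    have h1 : HasDerivAt (fun s => x s ⬝ᵥ y s) 0 τ := by
      refine (hasDerivAt_const τ (0 : ℝ)).congr_of_eventuallyEq ?_
      filter_upwards [Ioo_mem_nhds hτ.1 hτ.2] with σ hσ using hzero σ ⟨hσ.1.le, hσ.2.le⟩
    have h2 := h1.unique (h.hasDerivAt_dotProduct_self τ)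
    have h3 : y τ ⬝ᵥ Q *ᵥ y τ = 0 := by
      linarith [hK.dotProduct_mulVec_self_nonneg (x τ), hQ.dotProduct_mulVec_self_nonneg (y τ)]
    exact (hQ.dotProduct_mulVec_zero_iff (y τ)).1 (by simpa using h3)
  set c := 2 * ∑ i, ∑ j, |A i j|
  have hd : ∀ τ, HasDerivAt (fun τ => (x τ ⬝ᵥ x τ) * Real.exp (c * τ))
      ((2 * (x τ ⬝ᵥ (A *ᵥ x τ + Q *ᵥ y τ)) + c * (x τ ⬝ᵥ x τ)) * Real.exp (c * τ)) τ := by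
    intro τ
    have h1 : HasDerivAt (fun τ : ℝ => c * τ) (c * 1) τ := (hasDerivAt_id τ).const_mul c
    convert! (hasDerivAt_dotProduct (h.deriv_fst τ) (h.deriv_fst τ)).mul h1.exp using 1
    rw [dotProduct_comm (A *ᵥ x τ + Q *ᵥ y τ)]
    ring
  have hm : MonotoneOn (fun τ => (x τ ⬝ᵥ x τ) * Real.exp (c * τ)) (Icc 0 s) := by
    refine monotoneOn_of_hasDerivWithinAt_nonneg (convex_Icc 0 s)
      (fun τ _ => (hd τ).continuousAt.continuousWithinAt)
      (fun τ _ => (hd τ).hasDerivWithinAt) ?_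
    intro τ hτ
    rw [interior_Icc] at hτ
    rw [hQy τ hτ, add_zero]
    have := neg_abs_le (x τ ⬝ᵥ A *ᵥ x τ)
    have := Matrix.dotProduct_mulVec_self_le A (x τ)
    refine mul_nonneg ?_ (Real.exp_pos _).le
    linarith
  have := hm (left_mem_Icc.2 hs) (right_mem_Icc.2 hs) hs
  simp only [hxs, dotProduct_zero, zero_mul, mul_zero, Real.exp_zero, mul_one] at this
  have h0 : 0 ≤ x 0 ⬝ᵥ x 0 := Finset.sum_nonneg fun i _ => mul_self_nonneg _
  exact hx (dotProduct_self_eq_zero.1 (le_antisymm this h0))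

end IsHamiltonianFlow

/-- The solution is `P = Y X⁻¹`; `X` is returned too because it solves the closed-loop linear
equation and later serves for variation of constants. -/
theorem exists_riccati_solution [DecidableEq n] (A : Matrix n n ℝ) {Q K : Matrix n n ℝ}
    (hQ : Q.PosSemidef) (hK : K.PosSemidef) :
    ∃ P X : ℝ → Matrix n n ℝ, P 0 = 0 ∧ ∀ s, 0 ≤ s →
      (P s).PosSemidef ∧ HasDerivAt P (riccatiField A Q K (P s)) s ∧
      (riccatiField A Q K (P s)).PosSemidef ∧
      IsUnit (X s) ∧ HasDerivAt X ((A + Q * P s) * X s) s := by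
  obtain ⟨X, Y, hX0, hY0, hX, hY⟩ := exists_hamiltonian_fundamental A Q K
  have hflow : ∀ v : n → ℝ, IsHamiltonianFlow A Q K (fun s => X s *ᵥ v) (fun s => Y s *ᵥ v) := by
    refine fun v => ⟨fun s => ?_, fun s => ?_⟩
    · convert! (hX s).matrix_mulVec (hasDerivAt_const s v) using 1
      simp [add_mulVec]
    · convert! (hY s).matrix_mulVec (hasDerivAt_const s v) using 1
      simp [sub_mulVec]
  have hunit : ∀ s, 0 ≤ s → IsUnit (X s) := by
    intro s hs
    rw [← mulVec_injective_iff_isUnit, ← coe_mulVecLin, ← LinearMap.ker_eq_bot,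
      LinearMap.ker_eq_bot']
    intro v hv
    by_contra hv0
    exact (hflow v).fst_ne_zero hQ hK (by simp [hY0]) (by simpa [hX0] using hv0) hs
      (by simpa using hv)
  have hinv : ∀ s, 0 ≤ s → (X s)⁻¹ * X s = 1 := fun s hs =>
    nonsing_inv_mul _ ((isUnit_iff_isUnit_det _).1 (hunit s hs))
  have hinv' : ∀ s, 0 ≤ s → X s * (X s)⁻¹ = 1 := fun s hs =>
    mul_nonsing_inv _ ((isUnit_iff_isUnit_det _).1 (hunit s hs))
  have hsymm : ∀ s, 0 ≤ s → (Y s * (X s)⁻¹)ᵀ = Y s * (X s)⁻¹ := by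
    intro s hs
    ext i j
    -- The two flows reach basis vectors at time `s`, and their symplectic pairing vanishes at time
    -- `0` because `Y 0 = 0`.
    have h := (hflow ((X s)⁻¹ *ᵥ Pi.single i 1)).dotProduct_sub_dotProduct_eq hQ hK
      (hflow ((X s)⁻¹ *ᵥ Pi.single j 1)) s
    simp only [mulVec_mulVec, hinv' s hs, hY0, one_mulVec, zero_mulVec, zero_mul,
      dotProduct_zero, zero_dotProduct] at h
    simp at h
    rw [transpose_apply]
    linarith
  have hvec : ∀ s, 0 ≤ s → ∀ w : n → ℝ, X s *ᵥ ((X s)⁻¹ *ᵥ w) = w := fun s hs w => by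
    rw [mulVec_mulVec, hinv' s hs, one_mulVec]
  refine ⟨fun s => Y s * (X s)⁻¹, X, by simp [hY0], fun s hs => ⟨?_, ?_, ?_, hunit s hs, ?_⟩⟩
  · refine posSemidef_of_transpose_eq (hsymm s hs) fun w => ?_
    have := (hflow ((X s)⁻¹ *ᵥ w)).monotone_dotProduct hQ hK hs
    simpa [hY0, hinv' s hs, mulVec_mulVec] using this
  · convert! (hY s).matrix_mul ((hX s).matrix_inv (hunit s hs)) using 1
    simp only [riccatiField, Matrix.mul_neg, Matrix.sub_mul, Matrix.mul_add, Matrix.add_mul,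
      Matrix.mul_assoc, hinv' s hs, Matrix.mul_one]
    abel
  · refine posSemidef_of_transpose_eq ?_ fun w => ?_
    · exact riccatiField_transpose hQ.transpose_eq hK.transpose_eq (hsymm s hs)
    -- Pair a flow with its own time derivative, which is again a flow. The constant value is the
    -- form of `K` at time `0` and the form of `P'` in `w` at time `s`, so `P' ≥ 0`.
    · have h := (hflow ((X s)⁻¹ *ᵥ w)).dotProduct_sub_dotProduct_eq hQ hK
        (hflow ((X s)⁻¹ *ᵥ w)).deriv_flow s
      have h0 := hK.dotProduct_mulVec_self_nonneg ((X s)⁻¹ *ᵥ w)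
      simp only [hX0, hY0, one_mulVec, zero_mulVec, mulVec_zero, sub_zero, zero_dotProduct,
        hvec s hs] at h
      rw [← h] at h0
      have h1 : Y s *ᵥ (X s)⁻¹ *ᵥ w = (Y s * (X s)⁻¹) *ᵥ w := by rw [mulVec_mulVec]
      rw [h1] at h0
      set P := Y s * (X s)⁻¹ with hP
      have h2 : ∀ z, (P *ᵥ w) ⬝ᵥ z = w ⬝ᵥ P *ᵥ z := by
        intro z
        rw [dotProduct_mulVec, ← mulVec_transpose, hsymm s hs]
      rw [h2] at h0
      change 0 ≤ w ⬝ᵥ riccatiField A Q K P *ᵥ w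
      convert h0 using 1
      simp only [riccatiField, sub_mulVec, mulVec_add, dotProduct_sub, dotProduct_add, mulVec_mulVec,
        Matrix.mul_assoc]
      ring
  · convert! hX s using 1
    rw [Matrix.add_mul, Matrix.mul_assoc Q, Matrix.mul_assoc (Y s), hinv s hs, Matrix.mul_one]

end Hamiltonian

/-! ### Boundedness and convergence of the Riccati solution. -/

section RiccatiLimit

variable {n : Type*} [Fintype n]

/-- Completing the square around the gain `L` replaces `A` by the diagonal matrix `A + Q L`, at the
cost of `Lᵀ Q L`; the remaining square has a favourable sign. -/
theorem trace_riccatiField_le [DecidableEq n] {A Q K L P : Matrix n n ℝ} {δ : n → ℝ} {c : ℝ}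
    (hQ : Q.PosSemidef) (hP : P.PosSemidef) (hL : A + Q * L = diagonal δ) (hδ : ∀ i, c ≤ δ i) :
    (riccatiField A Q K P).trace ≤ -(2 * c) * P.trace + (K + Lᵀ * Q * L).trace := by
  have hA : A = diagonal δ - Q * L := by rw [← hL, add_sub_cancel_right]
  have hsq : 0 ≤ ((P - L)ᵀ * Q * (P - L)).trace := by
    have := (hQ.conjTranspose_mul_mul_same (P - L)).trace_nonneg
    rwa [conjTranspose_eq_transpose_of_trivial] at this
  have hid : riccatiField A Q K P =
      K + Lᵀ * Q * L - diagonal δ * P - P * diagonal δ - (P - L)ᵀ * Q * (P - L) := by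
    simp only [riccatiField, hA, transpose_sub, transpose_mul, hQ.transpose_eq, hP.transpose_eq,
      diagonal_transpose]
    noncomm_ring
  have hdiag : c * P.trace ≤ (diagonal δ * P).trace := by
    simp only [Matrix.trace, Finset.mul_sum, diag_apply, diagonal_mul]
    exact Finset.sum_le_sum fun i _ => mul_le_mul_of_nonneg_right (hδ i) hP.diag_nonneg
  rw [hid, trace_sub, trace_sub, trace_sub, trace_mul_comm P]
  linarith

theorem exists_trace_le_of_riccati [DecidableEq n] {A Q K L : Matrix n n ℝ}
    {P : ℝ → Matrix n n ℝ} {δ : n → ℝ} (hQ : Q.PosSemidef) (hL : A + Q * L = diagonal δ)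
    (hδ : ∀ i, 0 < δ i) (hP : ∀ s, 0 ≤ s → (P s).PosSemidef)
    (hP' : ∀ s, 0 ≤ s → HasDerivAt P (riccatiField A Q K (P s)) s) :
    ∃ B, ∀ s, 0 ≤ s → (P s).trace ≤ B := by
  obtain ⟨c, hc, hcδ⟩ := exists_pos_forall_le hδ
  set w := (K + Lᵀ * Q * L).trace
  refine ⟨w / (2 * c) + |(P 0).trace - w / (2 * c)|, fun s hs => ?_⟩
  have hd : ∀ s, 0 ≤ s → HasDerivAt (fun s => (P s).trace) (riccatiField A Q K (P s)).trace s :=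
    fun s hs => HasDerivAt.fun_sum fun i _ => hasDerivAt_matrix_iff.1 (hP' s hs) i i
  have h := le_of_hasDerivAt_le_neg_mul_add (mul_pos two_pos hc) hd
    (fun s hs => trace_riccatiField_le hQ (hP s hs) hL hcδ) hs
  refine h.trans (add_le_add_right ?_ _)
  refine (mul_le_mul_of_nonneg_right (le_abs_self _) (Real.exp_pos _).le).trans ?_
  refine mul_le_of_le_one_right (abs_nonneg _) (Real.exp_le_one_iff.2 ?_)
  nlinarith

theorem exists_tendsto_of_monotoneOn_Ici {f : ℝ → ℝ} {a B : ℝ} (hf : MonotoneOn f (Ici a))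
    (hB : ∀ s, a ≤ s → f s ≤ B) : ∃ l, Tendsto f atTop (𝓝 l) := by
  have hm : Monotone fun s => f (max s a) := fun s t hst =>
    hf (mem_Ici.2 (le_max_right s a)) (mem_Ici.2 (le_max_right t a)) (max_le_max_right a hst)
  rcases tendsto_atTop_of_monotone hm with h | ⟨l, hl⟩
  · obtain ⟨s, hs⟩ := (h.eventually (eventually_gt_atTop B)).exists
    exact absurd (hB _ (le_max_right s a)) (not_le.2 hs)
  · refine ⟨l, hl.congr' ?_⟩
    filter_upwards [eventually_ge_atTop a] with s hs
    rw [max_eq_left hs]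

/-- Every quadratic form of `P` is monotone. Those at basis vectors and at sums of two of them are
bounded through the trace, and polarization recovers the entries. -/
theorem exists_tendsto_of_posSemidef_deriv [DecidableEq n] {P P' : ℝ → Matrix n n ℝ} {B : ℝ}
    (hP : ∀ s, 0 ≤ s → (P s).PosSemidef) (hd : ∀ s, 0 ≤ s → HasDerivAt P (P' s) s)
    (hP' : ∀ s, 0 ≤ s → (P' s).PosSemidef) (hB : ∀ s, 0 ≤ s → (P s).trace ≤ B) :
    ∃ Pbar : Matrix n n ℝ, Tendsto P atTop (𝓝 Pbar) := by
  have hmono : ∀ v : n → ℝ, MonotoneOn (fun s => v ⬝ᵥ P s *ᵥ v) (Ici 0) := by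
    intro v
    have h1 : ∀ s, 0 ≤ s → HasDerivAt (fun s => v ⬝ᵥ P s *ᵥ v) (v ⬝ᵥ P' s *ᵥ v) s := by
      intro s hs
      have := hasDerivAt_dotProduct (hasDerivAt_const s v)
        ((hd s hs).matrix_mulVec (hasDerivAt_const s v))
      simpa using this
    exact monotoneOn_of_hasDerivWithinAt_nonneg (convex_Ici 0)
      (fun s hs => (h1 s hs).continuousAt.continuousWithinAt)
      (fun s hs => (h1 s (interior_subset hs)).hasDerivWithinAt)
      fun s hs => (hP' s (interior_subset hs)).dotProduct_mulVec_self_nonneg v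
  have hquad : ∀ i j, ∀ (s : ℝ) (a : ℝ), (Pi.single i 1 + a • Pi.single j 1 : n → ℝ) ⬝ᵥ
      P s *ᵥ (Pi.single i 1 + a • Pi.single j 1) =
      P s i i + a * P s j i + a * P s i j + a * a * P s j j := by
    intro i j s a
    simp [mulVec_add, mulVec_smul, add_dotProduct]
    ring
  have hdiag : ∀ s, 0 ≤ s → ∀ i, P s i i ≤ B := fun s hs i =>
    (Finset.single_le_sum (f := fun i => P s i i) (fun i _ => (hP s hs).diag_nonneg)
      (Finset.mem_univ i)).trans (hB s hs)
  have hsymm : ∀ s, 0 ≤ s → ∀ i j, P s j i = P s i j := fun s hs i j =>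
    congrFun (congrFun (hP s hs).transpose_eq i) j
  have hlim : ∀ i j (a : ℝ), (a = 0 ∨ a = 1) →
      ∃ l, Tendsto (fun s => P s i i + a * P s j i + a * P s i j + a * a * P s j j) atTop (𝓝 l) := by
    intro i j a ha
    refine exists_tendsto_of_monotoneOn_Ici (a := 0) (B := 4 * B) ?_ fun s hs => ?_
    · exact fun s hs t ht hst => by
        have h := hmono (Pi.single i 1 + a • Pi.single j 1) hs ht hst
        beta_reduce at h
        rw [hquad, hquad] at h
        exact h
    -- Nonnegativity at the difference of the two basis vectors controls the off-diagonal entry by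
    -- the diagonal ones, whence the bound `4 * B`.
    · have h1 := (hP s hs).dotProduct_mulVec_self_nonneg (Pi.single i 1 + (-1 : ℝ) • Pi.single j 1)
      rw [hquad] at h1
      have h2 := hdiag s hs i
      have h3 := hdiag s hs j
      have h4 := (hP s hs).diag_nonneg (i := i)
      rcases ha with rfl | rfl <;> linarith
  have hent : ∀ i j, ∃ l, Tendsto (fun s => P s i j) atTop (𝓝 l) := by
    intro i j
    obtain ⟨l₁, h₁⟩ := hlim i j 0 (Or.inl rfl)
    obtain ⟨l₂, h₂⟩ := hlim j j 0 (Or.inl rfl)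
    obtain ⟨l₃, h₃⟩ := hlim i j 1 (Or.inr rfl)
    refine ⟨(l₃ - l₁ - l₂) / 2, (((h₃.sub h₁).sub h₂).div_const 2).congr' ?_⟩
    filter_upwards [eventually_ge_atTop 0] with s hs
    rw [hsymm s hs i j]
    ring
  choose Pbar hPbar using hent
  exact ⟨Pbar, tendsto_pi_nhds.2 fun i => tendsto_pi_nhds.2 fun j => hPbar i j⟩

theorem continuous_riccatiField (A Q K : Matrix n n ℝ) : Continuous (riccatiField A Q K) := by
  unfold riccatiField
  fun_prop

theorem riccatiField_eq_zero_of_tendsto {A Q K Pbar : Matrix n n ℝ} {P : ℝ → Matrix n n ℝ}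
    (hd : ∀ s, 0 ≤ s → HasDerivAt P (riccatiField A Q K (P s)) s)
    (hP : Tendsto P atTop (𝓝 Pbar)) : riccatiField A Q K Pbar = 0 := by
  have h := ((continuous_riccatiField A Q K).tendsto Pbar).comp hP
  ext i j
  refine eq_zero_of_tendsto_of_hasDerivAt_tendsto
    (fun s hs => hasDerivAt_matrix_iff.1 (hd s hs) i j)
    (tendsto_pi_nhds.1 (tendsto_pi_nhds.1 hP i) j)
    (tendsto_pi_nhds.1 (tendsto_pi_nhds.1 h i) j)

theorem posSemidef_of_tendsto {Pbar : Matrix n n ℝ} {P : ℝ → Matrix n n ℝ}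
    (hP : ∀ s, 0 ≤ s → (P s).PosSemidef) (hlim : Tendsto P atTop (𝓝 Pbar)) :
    Pbar.PosSemidef := by
  refine posSemidef_of_transpose_eq ?_ fun x => ?_
  · refine tendsto_nhds_unique (((continuous_id.matrix_transpose).tendsto Pbar).comp hlim)
      (hlim.congr' ?_)
    filter_upwards [eventually_ge_atTop 0] with s hs using (hP s hs).transpose_eq.symm
  · have hc : Continuous fun B : Matrix n n ℝ => x ⬝ᵥ B *ᵥ x := by fun_prop
    refine ge_of_tendsto ((hc.tendsto Pbar).comp hlim) ?_
    filter_upwards [eventually_ge_atTop 0] with s hs using (hP s hs).dotProduct_mulVec_self_nonneg x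

end RiccatiLimit

/-! ### A strict Lyapunov matrix for the limiting closed loop. -/

section Lyapunov

variable {n : Type*} [Fintype n] [DecidableEq n]

/-- `P` alone gives only the semidefinite form `(K + P Q P) / 2`. Adding `ε I` creates the coercive
term `ε D`; the indefinite cross terms are absorbed by a square in `M` and a square in `Q`, leaving
only the error `-ε² S`. -/
theorem exists_lyapunov_of_riccatiField_eq_zero {S M A Q K P : Matrix n n ℝ} {δ : n → ℝ} {κ : ℝ}
    (hκ : κ < 0) (hδ : ∀ i, 0 < δ i) (hS : S.PosSemidef) (hM : M.PosSemidef) (hQ : Q.PosSemidef)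
    (hA : A = diagonal δ + κ • (S * M * diagonal δ))
    (hQeq : Q = (2 * κ) • (S * M * S) + (2 : ℝ) • S)
    (hKeq : K = -(κ / 2) • (diagonal δ * M * diagonal δ))
    (hP : P.PosSemidef) (hric : riccatiField A Q K P = 0) :
    ∃ X : Matrix n n ℝ, X.PosDef ∧ ∃ c > 0, ∀ y, c * (y ⬝ᵥ y) ≤ y ⬝ᵥ (X * (A + Q * P)) *ᵥ y := by
  obtain ⟨c, hc, hcδ⟩ := exists_pos_forall_le hδ
  set N := ∑ i, ∑ j, |S i j| with hN
  have hN0 : 0 ≤ N := Finset.sum_nonneg fun i _ => Finset.sum_nonneg fun j _ => abs_nonneg _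
  -- Small enough that `ε S` is at most `c / 2` as a form; the `+ 1` avoids division by zero.
  set ε := c / (2 * (N + 1)) with hε
  have hε0 : 0 < ε := by positivity
  have hεN : ε * N ≤ c / 2 := by
    rw [hε, div_mul_eq_mul_div, div_le_iff₀ (by positivity)]
    nlinarith
  refine ⟨P + ε • 1, PosDef.posSemidef_add hP (PosDef.one.smul hε0), ε * c / 2, by positivity,
    fun y => ?_⟩
  have hPs := dotProduct_mulVec_comm_of_transpose_eq hP.transpose_eq
  have hSs := dotProduct_mulVec_comm_of_transpose_eq hS.transpose_eq
  have hMs := dotProduct_mulVec_comm_of_transpose_eq hM.transpose_eq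
  have hQs := dotProduct_mulVec_comm_of_transpose_eq hQ.transpose_eq
  have hDs := dotProduct_mulVec_comm_of_transpose_eq (diagonal_transpose δ)
  have hyy : 0 ≤ y ⬝ᵥ y := Finset.sum_nonneg fun i _ => mul_self_nonneg _
  have h1 : y ⬝ᵥ K *ᵥ y = 2 * ((P *ᵥ y) ⬝ᵥ A *ᵥ y) + (P *ᵥ y) ⬝ᵥ Q *ᵥ P *ᵥ y := by
    have h := congrArg (fun B => y ⬝ᵥ B *ᵥ y) hric
    simp only [riccatiField, sub_mulVec, dotProduct_sub, zero_mulVec, dotProduct_zero,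
      ← mulVec_mulVec] at h
    rw [hPs y (A *ᵥ y), hPs y (Q *ᵥ P *ᵥ y), dotProduct_mulVec y Aᵀ, vecMul_transpose] at h
    rw [dotProduct_comm _ (A *ᵥ y), dotProduct_comm _ (Q *ᵥ P *ᵥ y)]
    linarith
  have h2 : y ⬝ᵥ ((P + ε • 1) * (A + Q * P)) *ᵥ y = (P *ᵥ y) ⬝ᵥ A *ᵥ y +
      (P *ᵥ y) ⬝ᵥ Q *ᵥ P *ᵥ y + ε * (y ⬝ᵥ A *ᵥ y + y ⬝ᵥ Q *ᵥ P *ᵥ y) := by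
    simp only [add_mulVec, Matrix.add_mul, Matrix.smul_mul, Matrix.one_mul, smul_mulVec,
      ← mulVec_mulVec, mulVec_add, dotProduct_add, dotProduct_smul, smul_eq_mul]
    rw [hPs y (A *ᵥ y), hPs y (Q *ᵥ P *ᵥ y), dotProduct_comm (P *ᵥ y), dotProduct_comm (P *ᵥ y)]
  have h3 : y ⬝ᵥ K *ᵥ y = -(κ / 2) * ((diagonal δ *ᵥ y) ⬝ᵥ M *ᵥ diagonal δ *ᵥ y) := by
    rw [hKeq, smul_mulVec, dotProduct_smul, ← mulVec_mulVec, ← mulVec_mulVec, hDs y,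
      dotProduct_comm, smul_eq_mul]
  have h4 : y ⬝ᵥ A *ᵥ y = y ⬝ᵥ diagonal δ *ᵥ y +
      κ * ((S *ᵥ y) ⬝ᵥ M *ᵥ diagonal δ *ᵥ y) := by
    rw [hA, add_mulVec, dotProduct_add, smul_mulVec, dotProduct_smul, ← mulVec_mulVec,
      ← mulVec_mulVec, hSs y, dotProduct_comm _ (S *ᵥ y), smul_eq_mul]
  have h5 : y ⬝ᵥ Q *ᵥ y = 2 * κ * ((S *ᵥ y) ⬝ᵥ M *ᵥ S *ᵥ y) + 2 * (y ⬝ᵥ S *ᵥ y) := by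
    rw [hQeq, add_mulVec, dotProduct_add, smul_mulVec, smul_mulVec, dotProduct_smul,
      dotProduct_smul, ← mulVec_mulVec, ← mulVec_mulVec, hSs y (M *ᵥ S *ᵥ y),
      dotProduct_comm _ (S *ᵥ y), smul_eq_mul, smul_eq_mul]
  -- The factor `2 * ε` matches the cross term `κ S M D` of `A`. The leftover `S M S` term cancels
  -- exactly against the one that `Q` contributes in `h7`.
  have h6 := hM.dotProduct_mulVec_self_nonneg (diagonal δ *ᵥ y - (2 * ε) • (S *ᵥ y))
  simp only [mulVec_sub, mulVec_smul, sub_dotProduct, dotProduct_sub, smul_dotProduct,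
    dotProduct_smul, smul_eq_mul] at h6
  rw [hMs (diagonal δ *ᵥ y) (S *ᵥ y)] at h6
  have h7 := hQ.dotProduct_mulVec_self_nonneg (P *ᵥ y + ε • y)
  simp only [mulVec_add, mulVec_smul, add_dotProduct, dotProduct_add, smul_dotProduct,
    dotProduct_smul, smul_eq_mul] at h7
  rw [hQs (P *ᵥ y) y] at h7
  have h8 : c * (y ⬝ᵥ y) ≤ y ⬝ᵥ diagonal δ *ᵥ y := by
    simp only [dotProduct, mulVec_diagonal, Finset.mul_sum]
    refine Finset.sum_le_sum fun i _ => ?_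
    have := mul_le_mul_of_nonneg_right (hcδ i) (mul_self_nonneg (y i))
    linarith
  have h9 := (le_abs_self _).trans (dotProduct_mulVec_self_le S y)
  rw [← hN] at h9
  rw [h2, h4]
  rw [h3] at h1
  rw [h5] at h7
  have h10 : ε * (y ⬝ᵥ S *ᵥ y) ≤ c / 2 * (y ⬝ᵥ y) := by
    calc ε * (y ⬝ᵥ S *ᵥ y) ≤ ε * (N * (y ⬝ᵥ y)) := mul_le_mul_of_nonneg_left h9 hε0.le
      _ = ε * N * (y ⬝ᵥ y) := by ring
      _ ≤ _ := mul_le_mul_of_nonneg_right hεN hyy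
  have h11 := mul_le_mul_of_nonneg_left h10 hε0.le
  have h12 := mul_le_mul_of_nonneg_left h8 hε0.le
  have h13 := mul_nonneg (neg_nonneg.2 hκ.le) h6
  linarith

end Lyapunov

/-! ### Dissipativity in a quadratic norm and its consequences. -/

section LinearStability

variable {n : Type*} [Fintype n] [DecidableEq n]

theorem Matrix.PosDef.exists_mul_dotProduct_self_le {Z : Matrix n n ℝ} (hZ : Z.PosDef) :
    ∃ k > 0, ∀ e, k * (e ⬝ᵥ e) ≤ e ⬝ᵥ Z *ᵥ e := by
  set N := ∑ i, ∑ j, |Z⁻¹ i j| with hN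
  have hN0 : 0 ≤ N := Finset.sum_nonneg fun i _ => Finset.sum_nonneg fun j _ => abs_nonneg _
  set t := (N + 1)⁻¹ with ht
  have ht0 : 0 < t := by positivity
  have htN : t * N ≤ 1 := by
    rw [ht, inv_mul_le_iff₀ (by positivity)]
    linarith
  refine ⟨t, ht0, fun e => ?_⟩
  have hZZ : Z * Z⁻¹ = 1 := mul_nonsing_inv _ ((isUnit_iff_isUnit_det _).1 hZ.isUnit)
  have hZe : Z *ᵥ (Z⁻¹ *ᵥ e) = e := by rw [mulVec_mulVec, hZZ, one_mulVec]
  have hZs := dotProduct_mulVec_comm_of_transpose_eq hZ.posSemidef.transpose_eq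
  -- Expanding gives `e·Ze ≥ 2t|e|² - t² e·Z⁻¹e`, so coercivity follows without any spectral theory.
  have h1 := hZ.posSemidef.dotProduct_mulVec_self_nonneg (e - t • (Z⁻¹ *ᵥ e))
  simp only [mulVec_sub, mulVec_smul, sub_dotProduct, dotProduct_sub, smul_dotProduct,
    dotProduct_smul, smul_eq_mul, hZe] at h1
  rw [hZs (Z⁻¹ *ᵥ e) e, hZe, dotProduct_comm (Z⁻¹ *ᵥ e) e] at h1
  have h2 := (le_abs_self _).trans (dotProduct_mulVec_self_le Z⁻¹ e)
  rw [← hN] at h2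
  have hee : 0 ≤ e ⬝ᵥ e := Finset.sum_nonneg fun i _ => mul_self_nonneg _
  have h3 := mul_le_mul_of_nonneg_left h2 (mul_self_nonneg t)
  have h4 := mul_le_mul_of_nonneg_left htN (mul_nonneg ht0.le hee)
  linarith

/-- Substituting `e = X y` turns the form of `X⁻¹ R` into that of `X Rᵀ`. The passage to the
transpose is needed because `R_c` is the transposed closed-loop matrix. -/
theorem exists_dissipative_inv_of_lyapunov {X R : Matrix n n ℝ} {c : ℝ} (hX : X.PosDef)
    (hc : 0 < c) (hXR : ∀ y, c * (y ⬝ᵥ y) ≤ y ⬝ᵥ (X * Rᵀ) *ᵥ y) :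
    ∃ c' > 0, ∀ e, c' * (e ⬝ᵥ e) ≤ e ⬝ᵥ (X⁻¹ * R) *ᵥ e := by
  set N := ∑ i, ∑ j, |(X * X) i j| with hN
  have hN0 : 0 ≤ N := Finset.sum_nonneg fun i _ => Finset.sum_nonneg fun j _ => abs_nonneg _
  refine ⟨c / (N + 1), by positivity, fun e => ?_⟩
  have hXs := dotProduct_mulVec_comm_of_transpose_eq hX.posSemidef.transpose_eq
  have hZs := dotProduct_mulVec_comm_of_transpose_eq hX.inv.posSemidef.transpose_eq
  have hXZ : X * X⁻¹ = 1 := mul_nonsing_inv _ ((isUnit_iff_isUnit_det _).1 hX.isUnit)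
  set y := X⁻¹ *ᵥ e with hy
  have he : e = X *ᵥ y := by rw [hy, mulVec_mulVec, hXZ, one_mulVec]
  have h1 : e ⬝ᵥ (X⁻¹ * R) *ᵥ e = y ⬝ᵥ (X * Rᵀ) *ᵥ y := by
    rw [← mulVec_mulVec, hZs e, ← hy, ← mulVec_mulVec, hXs y, ← he, dotProduct_comm,
      dotProduct_mulVec, ← mulVec_transpose, dotProduct_comm, dotProduct_comm]
  have h2 : e ⬝ᵥ e ≤ N * (y ⬝ᵥ y) := by
    have h3 : e ⬝ᵥ e = y ⬝ᵥ (X * X) *ᵥ y := by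
      rw [← mulVec_mulVec, hXs y, ← he]
    rw [h3]
    exact (le_abs_self _).trans (dotProduct_mulVec_self_le (X * X) y)
  have hyy : 0 ≤ y ⬝ᵥ y := Finset.sum_nonneg fun i _ => mul_self_nonneg _
  rw [h1, div_mul_eq_mul_div, div_le_iff₀ (by positivity)]
  have h3 := mul_le_mul_of_nonneg_right (hXR y) (by positivity : 0 ≤ N + 1)
  nlinarith [mul_le_mul_of_nonneg_left h2 hc.le, mul_nonneg hc.le hyy]

theorem tendsto_sum_abs_sub {n : Type*} [Fintype n] {α : Type*} {l : Filter α}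
    {B : α → Matrix n n ℝ} {B₀ : Matrix n n ℝ} (hB : Tendsto B l (𝓝 B₀)) :
    Tendsto (fun s => ∑ i, ∑ j, |(B s - B₀) i j|) l (𝓝 0) := by
  have hc : Continuous fun C : Matrix n n ℝ => ∑ i, ∑ j, |(C - B₀) i j| := by fun_prop
  have h := (hc.tendsto B₀).comp hB
  simpa [Function.comp_def] using h

theorem eventually_dissipative {n : Type*} [Fintype n] {α : Type*} {l : Filter α}
    {B : α → Matrix n n ℝ} {B₀ : Matrix n n ℝ} {c : ℝ} (hc : 0 < c) (hB : Tendsto B l (𝓝 B₀))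
    (h₀ : ∀ e, c * (e ⬝ᵥ e) ≤ e ⬝ᵥ B₀ *ᵥ e) :
    ∀ᶠ s in l, ∀ e, c / 2 * (e ⬝ᵥ e) ≤ e ⬝ᵥ B s *ᵥ e := by
  filter_upwards [(tendsto_sum_abs_sub hB).eventually (gt_mem_nhds (half_pos hc))] with s hs e
  have h1 := neg_abs_le (e ⬝ᵥ (B s - B₀) *ᵥ e)
  have h2 := dotProduct_mulVec_self_le (B s - B₀) e
  have h3 : 0 ≤ e ⬝ᵥ e := Finset.sum_nonneg fun i _ => mul_self_nonneg _
  have h4 := mul_le_mul_of_nonneg_right hs.le h3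
  rw [sub_mulVec, dotProduct_sub] at h1 h2
  linarith [h₀ e]

/-- Split an eigenvector into real and imaginary parts. Adding the two real forms cancels the
contribution of `z.im`, by symmetry of `Z`. -/
theorem re_pos_of_dissipative {Z R : Matrix n n ℝ} (hZ : Z.PosDef)
    (h : ∀ e, e ≠ 0 → 0 < e ⬝ᵥ (Z * R) *ᵥ e) {z : ℂ}
    (hz : Module.End.HasEigenvalue (Matrix.toLin' (R.map (algebraMap ℝ ℂ))) z) : 0 < z.re := by
  obtain ⟨x, hx⟩ := hz.exists_hasEigenvector
  have hx0 := hx.2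
  have hxe := hx.apply_eq_smul
  rw [toLin'_apply] at hxe
  set u : n → ℝ := fun i => (x i).re with hu
  set v : n → ℝ := fun i => (x i).im with hv
  have hRu : R *ᵥ u = z.re • u - z.im • v := by
    ext i
    have := congrArg Complex.re (congrFun hxe i)
    simpa [mulVec, dotProduct, Complex.re_sum, hu, hv] using this
  have hRv : R *ᵥ v = z.re • v + z.im • u := by
    ext i
    have := congrArg Complex.im (congrFun hxe i)
    simpa [mulVec, dotProduct, Complex.im_sum, hu, hv] using this
  have hsum : u ⬝ᵥ (Z * R) *ᵥ u + v ⬝ᵥ (Z * R) *ᵥ v =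
      z.re * (u ⬝ᵥ Z *ᵥ u + v ⬝ᵥ Z *ᵥ v) := by
    rw [← mulVec_mulVec, ← mulVec_mulVec, hRu, hRv, mulVec_sub, mulVec_add]
    simp only [mulVec_smul, dotProduct_sub, dotProduct_add, dotProduct_smul, smul_eq_mul]
    rw [dotProduct_mulVec_comm_of_transpose_eq hZ.posSemidef.transpose_eq u v]
    ring
  have hnn : ∀ e, 0 ≤ e ⬝ᵥ (Z * R) *ᵥ e := fun e => by
    by_cases he : e = 0
    · simp [he]
    · exact (h e he).le
  have hpos : 0 < u ⬝ᵥ (Z * R) *ᵥ u + v ⬝ᵥ (Z * R) *ᵥ v := by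
    by_cases hu0 : u = 0
    · have hv0 : v ≠ 0 := fun hv0 => hx0 (funext fun i =>
        Complex.ext (congrFun hu0 i) (congrFun hv0 i))
      linarith [hnn u, h v hv0]
    · linarith [hnn v, h u hu0]
  rw [hsum] at hpos
  exact pos_of_mul_pos_left hpos (add_nonneg (hZ.posSemidef.dotProduct_mulVec_self_nonneg u)
    (hZ.posSemidef.dotProduct_mulVec_self_nonneg v))

/-- The energy `e ⬝ᵥ Z *ᵥ e` decays up to a forcing term: Young's inequality spends half of the
dissipation on `g` and leaves `c⁻¹|Zg|²`, which tends to zero. -/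
theorem tendsto_zero_of_dissipative {Z : Matrix n n ℝ} {R : ℝ → Matrix n n ℝ}
    {e g : ℝ → n → ℝ} {c s₀ : ℝ} (hZ : Z.PosDef) (hc : 0 < c)
    (hR : ∀ s, s₀ ≤ s → ∀ x, c * (x ⬝ᵥ x) ≤ x ⬝ᵥ (Z * R s) *ᵥ x)
    (he : ∀ s, s₀ ≤ s → HasDerivAt e (-(R s *ᵥ e s) + g s) s)
    (hg : Tendsto g atTop (𝓝 0)) : Tendsto e atTop (𝓝 0) := by
  set N := ∑ i, ∑ j, |Z i j| with hN
  have hN0 : 0 ≤ N := Finset.sum_nonneg fun i _ => Finset.sum_nonneg fun j _ => abs_nonneg _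
  have hnn : ∀ x : n → ℝ, 0 ≤ x ⬝ᵥ x := fun x => Finset.sum_nonneg fun i _ => mul_self_nonneg _
  have hZs := dotProduct_mulVec_comm_of_transpose_eq hZ.posSemidef.transpose_eq
  have hU : Tendsto (fun s => e s ⬝ᵥ Z *ᵥ e s) atTop (𝓝 0) := by
    refine tendsto_zero_of_hasDerivAt_le_neg_mul_add (a := c / (N + 1)) (s₀ := s₀)
      (h := fun s => c⁻¹ * ((Z *ᵥ g s) ⬝ᵥ (Z *ᵥ g s))) (by positivity)
      (fun s _ => hZ.posSemidef.dotProduct_mulVec_self_nonneg _)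
      (fun s hs => hasDerivAt_dotProduct (he s hs) (HasDerivAt.const_mulVec (he s hs) Z))
      (fun s hs => ?_) ?_
    · have h1 : (-(R s *ᵥ e s) + g s) ⬝ᵥ Z *ᵥ e s + e s ⬝ᵥ Z *ᵥ (-(R s *ᵥ e s) + g s) =
          -2 * (e s ⬝ᵥ (Z * R s) *ᵥ e s) + 2 * (e s ⬝ᵥ Z *ᵥ g s) := by
        rw [hZs (-(R s *ᵥ e s) + g s), mulVec_add, mulVec_neg, mulVec_mulVec, dotProduct_add,
          dotProduct_neg]
        ring
      rw [h1]
      have h2 := hR s hs (e s)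
      have h3 := hnn (c • e s - Z *ᵥ g s)
      simp only [sub_dotProduct, dotProduct_sub, smul_dotProduct, dotProduct_smul,
        smul_eq_mul] at h3
      rw [dotProduct_comm (Z *ᵥ g s) (e s)] at h3
      have h4 : e s ⬝ᵥ Z *ᵥ e s ≤ N * (e s ⬝ᵥ e s) :=
        (le_abs_self _).trans (dotProduct_mulVec_self_le Z (e s))
      have h5 : c / (N + 1) * (e s ⬝ᵥ Z *ᵥ e s) ≤ c * (e s ⬝ᵥ e s) := by
        rw [div_mul_eq_mul_div, div_le_iff₀ (by positivity)]
        nlinarith [mul_le_mul_of_nonneg_left h4 hc.le, mul_nonneg hc.le (hnn (e s))]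
      have h6 : 2 * (e s ⬝ᵥ Z *ᵥ g s) ≤
          c * (e s ⬝ᵥ e s) + c⁻¹ * ((Z *ᵥ g s) ⬝ᵥ (Z *ᵥ g s)) := by
        have h7 := mul_nonneg (inv_pos.2 hc).le h3
        have h8 : c⁻¹ * (c * (c * (e s ⬝ᵥ e s)) - c * (e s ⬝ᵥ Z *ᵥ g s) -
            (c * (e s ⬝ᵥ Z *ᵥ g s) - (Z *ᵥ g s) ⬝ᵥ (Z *ᵥ g s))) =
            c * (e s ⬝ᵥ e s) + c⁻¹ * ((Z *ᵥ g s) ⬝ᵥ (Z *ᵥ g s)) - 2 * (e s ⬝ᵥ Z *ᵥ g s) := by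
          field_simp
          ring
        linarith
      linarith
    · have hcont : Continuous fun x : n → ℝ => c⁻¹ * ((Z *ᵥ x) ⬝ᵥ (Z *ᵥ x)) := by fun_prop
      have := (hcont.tendsto 0).comp hg
      simpa [Function.comp_def] using this
  obtain ⟨k, hk, hkZ⟩ := hZ.exists_mul_dotProduct_self_le
  rw [tendsto_pi_nhds]
  intro i
  have hU' : Tendsto (fun s => Real.sqrt (k⁻¹ * (e s ⬝ᵥ Z *ᵥ e s))) atTop (𝓝 0) := by
    have := (Real.continuous_sqrt.tendsto _).comp (hU.const_mul k⁻¹)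
    simpa [Function.comp_def] using this
  refine squeeze_zero_norm (fun s => ?_) hU'
  rw [Real.norm_eq_abs, ← Real.sqrt_sq_eq_abs]
  refine Real.sqrt_le_sqrt ?_
  have h1 : e s i * e s i ≤ e s ⬝ᵥ e s :=
    Finset.single_le_sum (f := fun i => e s i * e s i) (fun i _ => mul_self_nonneg _)
      (Finset.mem_univ i)
  rw [inv_mul_eq_div, le_div_iff₀ hk]
  nlinarith [hkZ (e s)]

end LinearStability

/-! ### The linear equation: existence and steady state. -/

section LinearEquation

variable {n : Type*} [Fintype n] [DecidableEq n]

/-- Variation of constants: `(X⁻¹)ᵀ` solves the homogeneous adjoint equation. -/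
theorem exists_linear_solution {X G : ℝ → Matrix n n ℝ} {f : ℝ → n → ℝ}
    (hu : ∀ s, 0 ≤ s → IsUnit (X s)) (hX : ∀ s, 0 ≤ s → HasDerivAt X (G s * X s) s)
    (hf : ContinuousOn f (Ici 0)) :
    ∃ b : ℝ → n → ℝ, b 0 = 0 ∧ ∀ s, 0 ≤ s → HasDerivAt b (-((G s)ᵀ *ᵥ b s) - f s) s := by
  -- Freezing the data at time `0` for negative times makes the integrand continuous on all of `ℝ`.
  have hmax : ∀ τ : ℝ, max τ 0 ∈ Ici (0 : ℝ) := fun τ => le_max_right τ 0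
  have hXc : Continuous fun τ => X (max τ 0) :=
    ContinuousOn.comp_continuous (s := Ici 0)
      (fun s hs => continuousAt_pi.2 (fun i => continuousAt_pi.2 fun j =>
        (hasDerivAt_matrix_iff.1 (hX s hs) i j).continuousAt) |>.continuousWithinAt)
      (by fun_prop) hmax
  have hfc : Continuous fun τ => f (max τ 0) := hf.comp_continuous (by fun_prop) hmax
  have hg : Continuous fun τ => (X (max τ 0))ᵀ *ᵥ f (max τ 0) :=
    hXc.matrix_transpose.matrix_mulVec hfc
  set J : ℝ → n → ℝ := fun s => ∫ τ in (0 : ℝ)..s, (X (max τ 0))ᵀ *ᵥ f (max τ 0) with hJ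
  have hJ' : ∀ s, 0 ≤ s → HasDerivAt J ((X s)ᵀ *ᵥ f s) s := by
    intro s hs
    have := hg.integral_hasStrictDerivAt 0 s |>.hasDerivAt
    rwa [max_eq_left hs] at this
  refine ⟨fun s => -(((X s)⁻¹)ᵀ *ᵥ J s), by simp [hJ], fun s hs => ?_⟩
  have hXX : X s * (X s)⁻¹ = 1 := mul_nonsing_inv _ ((isUnit_iff_isUnit_det _).1 (hu s hs))
  convert! ((((hX s hs).matrix_inv (hu s hs)).matrix_transpose).matrix_mulVec (hJ' s hs)).neg using 1
  have h1 : ((X s)⁻¹)ᵀ * (X s)ᵀ = 1 := by rw [← transpose_mul, hXX, transpose_one]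
  have h2 : (-((X s)⁻¹ * (G s * X s) * (X s)⁻¹))ᵀ = -((G s)ᵀ * ((X s)⁻¹)ᵀ) := by
    rw [Matrix.mul_assoc, Matrix.mul_assoc, hXX, Matrix.mul_one, transpose_neg, transpose_mul]
  rw [h2, mulVec_mulVec, h1, one_mulVec, neg_mulVec, mulVec_neg, mulVec_mulVec]
  abel

theorem exists_tendsto_of_dissipative {Z Rbar : Matrix n n ℝ} {R : ℝ → Matrix n n ℝ}
    {b f : ℝ → n → ℝ} {fbar : n → ℝ} {c : ℝ} (hZ : Z.PosDef) (hc : 0 < c)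
    (hZR : ∀ e, c * (e ⬝ᵥ e) ≤ e ⬝ᵥ (Z * Rbar) *ᵥ e)
    (hR : Tendsto R atTop (𝓝 Rbar)) (hf : Tendsto f atTop (𝓝 fbar))
    (hb : ∀ s, 0 ≤ s → HasDerivAt b (-(R s *ᵥ b s) - f s) s) :
    ∃ bbar, Tendsto b atTop (𝓝 bbar) := by
  -- Dissipativity kills the kernel, so the limiting equation has a stationary point `bbar`. The
  -- error `b - bbar` then solves a dissipative equation with vanishing forcing.
  have hinj : Function.Injective (Matrix.mulVecLin Rbar) := by
    rw [← LinearMap.ker_eq_bot, LinearMap.ker_eq_bot']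
    intro v hv
    have h1 := hZR v
    rw [mulVecLin_apply] at hv
    rw [← mulVec_mulVec, hv, mulVec_zero, dotProduct_zero] at h1
    have h2 : 0 ≤ v ⬝ᵥ v := Finset.sum_nonneg fun i _ => mul_self_nonneg _
    exact dotProduct_self_eq_zero.1 (le_antisymm (nonpos_of_mul_nonpos_right h1 hc) h2)
  obtain ⟨bbar, hbbar⟩ := LinearMap.injective_iff_surjective.1 hinj (-fbar)
  rw [mulVecLin_apply] at hbbar
  refine ⟨bbar, ?_⟩
  have hZRlim : Tendsto (fun s => Z * R s) atTop (𝓝 (Z * Rbar)) := by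
    have hcont : Continuous fun B : Matrix n n ℝ => Z * B := by fun_prop
    exact (hcont.tendsto Rbar).comp hR
  obtain ⟨s₀, hs₀⟩ := eventually_atTop.1 (eventually_dissipative hc hZRlim hZR)
  have hg : Tendsto (fun s => -(R s *ᵥ bbar) - f s) atTop (𝓝 0) := by
    have hcont : Continuous fun B : Matrix n n ℝ => -(B *ᵥ bbar) := by fun_prop
    have := ((hcont.tendsto Rbar).comp hR).sub hf
    rwa [hbbar, neg_neg, sub_self] at this
  have he := tendsto_zero_of_dissipative (e := fun s => b s - bbar) (s₀ := max s₀ 0) hZ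
    (half_pos hc) (fun s hs => hs₀ s ((le_max_left _ _).trans hs))
    (fun s hs => by
      convert! (hb s ((le_max_right _ _).trans hs)).sub_const bbar using 1
      rw [mulVec_sub]
      abel) hg
  simpa using he.add_const bbar

end LinearEquation

/-! ### Backward uniqueness for smooth autonomous systems. -/

theorem eqOn_Iic_of_hasDerivWithinAt_of_contDiff {E : Type*} [NormedAddCommGroup E]
    [NormedSpace ℝ E] [ProperSpace E] {V : E → E} (hV : ContDiff ℝ 1 V) {f g : ℝ → E} {T : ℝ}
    (hf : ∀ t ≤ T, HasDerivWithinAt f (V (f t)) (Iic T) t)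
    (hg : ∀ t ≤ T, HasDerivWithinAt g (V (g t)) (Iic T) t) (hT : f T = g T) :
    EqOn f g (Iic T) := by
  intro t ht
  have hcont : ∀ {h : ℝ → E}, (∀ t ≤ T, HasDerivWithinAt h (V (h t)) (Iic T) t) →
      ContinuousOn h (Icc t T) := fun hh s hs =>
    (hh s hs.2).continuousWithinAt.mono Icc_subset_Iic_self
  have hbdd : Bornology.IsBounded (f '' Icc t T ∪ g '' Icc t T) :=
    ((isCompact_Icc.image_of_continuousOn (hcont hf)).union
      (isCompact_Icc.image_of_continuousOn (hcont hg))).isBounded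
  -- On `[t, T]` both trajectories stay in one compact ball, where the field has a single Lipschitz
  -- constant.
  obtain ⟨r, hr⟩ := hbdd.subset_closedBall 0
  obtain ⟨L, hL⟩ := LocallyLipschitzOn.exists_lipschitzOnWith_of_compact
    (isCompact_closedBall (0 : E) r) (hV.locallyLipschitz.locallyLipschitzOn)
  refine ODE_solution_unique_of_mem_Icc_left (v := fun _ => V) (s := fun _ => Metric.closedBall 0 r)
    (fun _ _ => hL) (hcont hf) (fun s hs => (hf s hs.2).mono (Iic_subset_Iic.2 hs.2))
    (fun s hs => hr (Or.inl ⟨s, Ioc_subset_Icc_self hs, rfl⟩)) (hcont hg)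
    (fun s hs => (hg s hs.2).mono (Iic_subset_Iic.2 hs.2))
    (fun s hs => hr (Or.inr ⟨s, Ioc_subset_Icc_self hs, rfl⟩)) hT (left_mem_Icc.2 ht)

/-! ### Algebra of the Riccati coefficients. -/

section RiccatiCoefficients

variable {n : Type*} [Fintype n] {S M : Matrix n n ℝ} {κ : ℝ}

/-- The matrix is `2(1 + κ) S - 2κ (S - S M S)`, and `S - S M S = (1 - S M) S (1 - S M)ᵀ` thanks to
`M S M = M`. -/
theorem posSemidef_riccati_quadratic [DecidableEq n] (hS : S.PosSemidef) (hM : M.PosSemidef)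
    (hMSM : M * S * M = M) (hκ : κ ≤ 0) (hκ' : -1 ≤ κ) :
    ((2 * κ) • (S * M * S) + (2 : ℝ) • S).PosSemidef := by
  have h1 : (1 - S * M) * S * (1 - S * M)ᵀ = S - S * M * S := by
    rw [transpose_sub, transpose_one, transpose_mul, hS.transpose_eq, hM.transpose_eq]
    calc (1 - S * M) * S * (1 - M * S) = S - S * M * S - S * M * S + S * (M * S * M) * S := by
          noncomm_ring
      _ = _ := by rw [hMSM]; noncomm_ring
  have h2 : (S - S * M * S).PosSemidef := by
    rw [← h1, ← conjTranspose_eq_transpose_of_trivial]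
    exact hS.mul_mul_conjTranspose_same _
  have h3 : (2 * κ) • (S * M * S) + (2 : ℝ) • S =
      (2 * (1 + κ)) • S + (-2 * κ) • (S - S * M * S) := by
    module
  rw [h3]
  exact (hS.smul (by linarith)).add (h2.smul (by linarith))

/-- Since `S M S M D = S M D`, a gain `ℓ M D` contributes `2(1 + κ) ℓ S M D`; the chosen `ℓ` cancels
the `κ` term. -/
theorem riccati_stabilizing_gain (D : Matrix n n ℝ) (hMSM : M * S * M = M) (hκ : -1 < κ) :
    (D + κ • (S * M * D)) + ((2 * κ) • (S * M * S) + (2 : ℝ) • S) *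
      ((-κ / (2 * (1 + κ))) • (M * D)) = D := by
  have h1 : S * M * S * (M * D) = S * M * D := by
    calc S * M * S * (M * D) = S * (M * S * M) * D := by noncomm_ring
      _ = _ := by rw [hMSM]
  have h2 : S * (M * D) = S * M * D := (Matrix.mul_assoc _ _ _).symm
  have h3 : (1 + κ) ≠ 0 := by linarith
  rw [Matrix.mul_smul, Matrix.add_mul, Matrix.smul_mul, Matrix.smul_mul, h1, h2, ← add_smul,
    smul_smul, add_assoc, ← add_smul]
  have h4 : κ + -κ / (2 * (1 + κ)) * (2 * κ + 2) = 0 := by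
    field_simp
    ring
  rw [h4, zero_smul, add_zero]

end RiccatiCoefficients

/-! ### The coefficients of the model, and uniqueness for its system. -/

namespace CointegrationModel

variable {d m : ℕ} {p : CointegrationModel d m}

theorem beta_mul_sigma0 (h0 : p.sigma0.PosDef) : p.beta * p.sigma0 = p.psi1 * p.psi0ᵀ := by
  rw [beta, Matrix.mul_assoc, nonsing_inv_mul _ ((isUnit_iff_isUnit_det _).1 h0.isUnit),
    Matrix.mul_one]

theorem sigma0_transpose : p.sigma0ᵀ = p.sigma0 := by
  rw [sigma0, transpose_mul, transpose_transpose]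

theorem beta_mul_psi0_mul_psi1_transpose (h0 : p.sigma0.PosDef) :
    p.beta * p.psi0 * p.psi1ᵀ = p.beta * p.sigma0 * p.betaᵀ := by
  have h : (p.beta * p.sigma0)ᵀ = p.psi0 * p.psi1ᵀ := by
    rw [beta_mul_sigma0 h0, transpose_mul, transpose_transpose]
  rw [Matrix.mul_assoc, ← h, transpose_mul, sigma0_transpose, ← Matrix.mul_assoc]

theorem sigma2_eq_sigma3 (h0 : p.sigma0.PosDef) : p.sigma2 = p.sigma3 := by
  rw [sigma3, beta_mul_psi0_mul_psi1_transpose h0, sub_add_cancel, sigma2]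

theorem sigma3_posSemidef : p.sigma3.PosSemidef := by
  have h : p.sigma3 = (p.psi1 - p.beta * p.psi0) * (p.psi1 - p.beta * p.psi0)ᴴ := by
    rw [conjTranspose_eq_transpose_of_trivial, transpose_sub, transpose_mul, sigma3, sigma1, sigma0]
    simp only [Matrix.sub_mul, Matrix.mul_sub, Matrix.mul_assoc]
    abel
  rw [h]
  exact posSemidef_self_mul_conjTranspose _

/-- The matrix `Σ₁⁻¹ - Σ_c` of the market-neutral problem. -/
noncomputable def neutralPrecision (p : CointegrationModel d m) : Matrix (Fin d) (Fin d) ℝ :=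
  p.sigma1⁻¹ - p.sigmaC

theorem posDef_betaT_mul_inv_mul_beta (h1 : p.sigma1.PosDef)
    (hbeta : (p.betaᵀ * p.beta).rank = m) : (p.betaᵀ * p.sigma1⁻¹ * p.beta).PosDef := by
  have hsurj : Function.Surjective (p.betaᵀ * p.beta).mulVecLin := by
    rw [← LinearMap.range_eq_top]
    refine Submodule.eq_top_of_finrank_eq ?_
    rw [Module.finrank_fin_fun]
    exact hbeta
  have hinj := LinearMap.injective_iff_surjective.2 hsurj
  have := h1.inv.conjTranspose_mul_mul_same (B := p.beta) (fun v w hvw => hinj (by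
    simp only [mulVecLin_apply, ← mulVec_mulVec]
    rw [hvw]))
  rwa [conjTranspose_eq_transpose_of_trivial] at this

theorem neutralPrecision_mul_beta (h1 : p.sigma1.PosDef) (hbeta : (p.betaᵀ * p.beta).rank = m) :
    p.neutralPrecision * p.beta = 0 := by
  have hu := (isUnit_iff_isUnit_det _).1 (posDef_betaT_mul_inv_mul_beta h1 hbeta).isUnit
  have h : p.sigmaC * p.beta = p.sigma1⁻¹ * p.beta *
      ((p.betaᵀ * p.sigma1⁻¹ * p.beta)⁻¹ * (p.betaᵀ * p.sigma1⁻¹ * p.beta)) := by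
    simp only [sigmaC, Matrix.mul_assoc]
  rw [neutralPrecision, Matrix.sub_mul, h, nonsing_inv_mul _ hu, Matrix.mul_one, sub_self]

theorem neutralPrecision_transpose (h1 : p.sigma1.PosDef) :
    p.neutralPrecisionᵀ = p.neutralPrecision := by
  have h := h1.posSemidef.transpose_eq
  simp only [neutralPrecision, sigmaC, transpose_sub, transpose_mul, transpose_nonsing_inv, h,
    transpose_transpose, Matrix.mul_assoc]

theorem neutralPrecision_mul_sigma1_mul (h1 : p.sigma1.PosDef)
    (hbeta : (p.betaᵀ * p.beta).rank = m) :
    p.neutralPrecision * p.sigma1 * p.neutralPrecision = p.neutralPrecision := by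
  have hu := (isUnit_iff_isUnit_det _).1 h1.isUnit
  have hc : p.neutralPrecision * p.sigma1 * p.sigmaC = 0 := by
    have : p.neutralPrecision * p.sigma1 * p.sigmaC = p.neutralPrecision *
        (p.sigma1 * p.sigma1⁻¹) * p.beta * ((p.betaᵀ * p.sigma1⁻¹ * p.beta)⁻¹ *
          p.betaᵀ * p.sigma1⁻¹) := by
      simp only [sigmaC, Matrix.mul_assoc]
    rw [this, mul_nonsing_inv _ hu, Matrix.mul_one, neutralPrecision_mul_beta h1 hbeta,
      Matrix.zero_mul]
  calc p.neutralPrecision * p.sigma1 * p.neutralPrecision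
      = p.neutralPrecision * p.sigma1 * p.sigma1⁻¹ - p.neutralPrecision * p.sigma1 * p.sigmaC := by
        rw [← Matrix.mul_sub]; rfl
    _ = p.neutralPrecision := by
        rw [hc, sub_zero, Matrix.mul_assoc, mul_nonsing_inv _ hu, Matrix.mul_one]

/-- `M = Mᵀ Σ₁ M`, so positivity is inherited from `Σ₁`. -/
theorem neutralPrecision_posSemidef (h1 : p.sigma1.PosDef)
    (hbeta : (p.betaᵀ * p.beta).rank = m) : p.neutralPrecision.PosSemidef := by
  have h := h1.posSemidef.conjTranspose_mul_mul_same p.neutralPrecision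
  rwa [conjTranspose_eq_transpose_of_trivial, neutralPrecision_transpose h1,
    neutralPrecision_mul_sigma1_mul h1 hbeta] at h

/-- `Σ₃` differs from `Σ₁` by `β Σ₀ βᵀ`, which `M` annihilates. -/
theorem neutralPrecision_mul_sigma3_mul (h0 : p.sigma0.PosDef) (h1 : p.sigma1.PosDef)
    (hbeta : (p.betaᵀ * p.beta).rank = m) :
    p.neutralPrecision * p.sigma3 * p.neutralPrecision = p.neutralPrecision := by
  rw [← sigma2_eq_sigma3 h0, sigma2, ← beta_mul_sigma0 h0, Matrix.mul_sub, ← Matrix.mul_assoc,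
    ← Matrix.mul_assoc, neutralPrecision_mul_beta h1 hbeta, Matrix.zero_mul, Matrix.zero_mul,
    sub_zero, neutralPrecision_mul_sigma1_mul h1 hbeta]

/-- The factor `γ / (1 - γ)`. -/
noncomputable def riskRatio (p : CointegrationModel d m) : ℝ := p.gamma / (1 - p.gamma)

theorem riskRatio_neg (hgamma : p.gamma < 0) : p.riskRatio < 0 :=
  div_neg_of_neg_of_pos hgamma (by linarith)

theorem neg_one_lt_riskRatio (hgamma : p.gamma < 0) : -1 < p.riskRatio := by
  rw [riskRatio, lt_div_iff₀ (by linarith)]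
  linarith

/-- The linear coefficient of the Riccati equation. -/
noncomputable def driftCoeff (p : CointegrationModel d m) : Matrix (Fin d) (Fin d) ℝ :=
  p.deltaMat + p.riskRatio • (p.sigma3 * p.neutralPrecision * p.deltaMat)

/-- The quadratic coefficient of the Riccati equation. -/
noncomputable def quadCoeff (p : CointegrationModel d m) : Matrix (Fin d) (Fin d) ℝ :=
  (2 * p.riskRatio) • (p.sigma3 * p.neutralPrecision * p.sigma3) + (2 : ℝ) • p.sigma3

/-- The constant coefficient of the Riccati equation. -/
noncomputable def constCoeff (p : CointegrationModel d m) : Matrix (Fin d) (Fin d) ℝ :=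
  -(p.riskRatio / 2) • (p.deltaMat * p.neutralPrecision * p.deltaMat)

theorem riccatiRHS_neg (h0 : p.sigma0.PosDef) (P : Matrix (Fin d) (Fin d) ℝ) :
    p.riccatiRHS (-P) = riccatiField p.driftCoeff p.quadCoeff p.constCoeff P := by
  have hk : p.gamma / (2 * (1 - p.gamma)) = p.riskRatio / 2 := by
    rw [riskRatio, div_div, mul_comm]
  have hk' : 2 * p.gamma / (1 - p.gamma) = 2 * p.riskRatio := mul_div_assoc _ _ _
  have hk'' : p.gamma / (1 - p.gamma) = p.riskRatio := rfl
  have hM : p.sigma1⁻¹ - p.sigmaC = p.neutralPrecision := rfl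
  rw [riccatiRHS, sigma2_eq_sigma3 h0, sigma3_posSemidef.transpose_eq, hk, hk', hk'', hM,
    add_comm _ p.deltaMat]
  change -(-P * p.quadCoeff * -P) + -P * p.driftCoeff + p.driftCoeffᵀ * -P - _ = _
  rw [riccatiField, constCoeff]
  simp only [Matrix.neg_mul, Matrix.mul_neg, neg_neg, neg_smul]
  abel

theorem Rc_neg (h0 : p.sigma0.PosDef) (h1 : p.sigma1.PosDef) {P : Matrix (Fin d) (Fin d) ℝ}
    (hP : Pᵀ = P) (hQ : p.quadCoeff.PosSemidef) :
    p.Rc (-P) = (p.driftCoeff + p.quadCoeff * P)ᵀ := by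
  have hk' : 2 * p.gamma / (1 - p.gamma) = 2 * p.riskRatio := mul_div_assoc _ _ _
  have hk'' : p.gamma / (1 - p.gamma) = p.riskRatio := rfl
  have hM : p.sigma1⁻¹ - p.sigmaC = p.neutralPrecision := rfl
  have hA : p.driftCoeffᵀ =
      p.deltaMat + p.riskRatio • (p.deltaMat * p.neutralPrecision * p.sigma3) := by
    rw [driftCoeff, transpose_add, transpose_smul, transpose_mul, transpose_mul, deltaMat,
      diagonal_transpose, neutralPrecision_transpose h1, sigma3_posSemidef.transpose_eq,
      Matrix.mul_assoc]
  rw [transpose_add, transpose_mul, hP, hQ.transpose_eq, hA, Rc, sigma2_eq_sigma3 h0,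
    sigma3_posSemidef.transpose_eq, hk', hk'', hM, add_comm _ p.deltaMat]
  change -(-P * p.quadCoeff) + _ = _
  rw [Matrix.neg_mul, neg_neg, add_comm]

theorem continuous_forcing (p : CointegrationModel d m) : Continuous p.forcing := by
  unfold forcing
  fun_prop

/-- The joint vector field of the equations for `C` and `b`. -/
noncomputable def systemField (p : CointegrationModel d m)
    (z : (Fin d → Fin d → ℝ) × (Fin d → ℝ)) : (Fin d → Fin d → ℝ) × (Fin d → ℝ) :=
  (fun i j => p.riccatiRHS (of z.1) i j, p.Rc (of z.1) *ᵥ z.2 + p.forcing (of z.1))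

theorem contDiff_systemField (p : CointegrationModel d m) : ContDiff ℝ 1 p.systemField := by
  refine ContDiff.prodMk ?_ ?_
  · refine contDiff_pi.2 fun i => contDiff_pi.2 fun j => ?_
    simp only [riccatiRHS, Matrix.sub_apply, Matrix.add_apply, Matrix.neg_apply,
      mul_apply (M := of _), mul_apply (N := of _), of_apply]
    fun_prop
  · refine contDiff_pi.2 fun i => ?_
    simp only [Rc, forcing, mulVec, dotProduct, Pi.add_apply, Pi.neg_apply, Matrix.add_apply,
      Matrix.neg_apply, mul_apply (M := of _), of_apply]
    fun_prop

theorem IsSolution.eq {T : ℝ} {C C' : ℝ → Matrix (Fin d) (Fin d) ℝ} {b b' : ℝ → Fin d → ℝ}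
    (h : p.IsSolution T C b) (h' : p.IsSolution T C' b') {t : ℝ} (ht : t ≤ T) :
    C' t = C t ∧ b' t = b t := by
  have hd : ∀ {C : ℝ → Matrix (Fin d) (Fin d) ℝ} {b : ℝ → Fin d → ℝ}, p.IsSolution T C b →
      ∀ t ≤ T, HasDerivWithinAt (fun s => ((fun i j => C s i j, b s) :
        (Fin d → Fin d → ℝ) × (Fin d → ℝ))) (p.systemField (fun i j => C t i j, b t)) (Iic T) t :=
    fun h t ht => HasDerivWithinAt.prodMk
      (hasDerivWithinAt_pi.2 fun i => hasDerivWithinAt_pi.2 fun j => h.deriv_C t ht i j)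
      (hasDerivWithinAt_pi.2 fun i => h.deriv_b t ht i)
  have heq := eqOn_Iic_of_hasDerivWithinAt_of_contDiff p.contDiff_systemField (hd h') (hd h)
    (by simp only [h.terminal_C, h.terminal_b, h'.terminal_C, h'.terminal_b]) (mem_Iic.2 ht)
  rw [Prod.mk.injEq] at heq
  exact heq

end CointegrationModel

/-! ### Assembly in original time. -/

theorem mainTheorem5 {d m : ℕ} (p : CointegrationModel d m) (T : ℝ)
    (hSigma0 : p.sigma0.PosDef) (hSigma1 : p.sigma1.PosDef)
    (hdelta : ∀ i, 0 < p.delta i)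
    (hbeta : (p.betaᵀ * p.beta).rank = m)
    (hgamma : p.gamma < 0) :
    ∃ (C : ℝ → Matrix (Fin d) (Fin d) ℝ) (b : ℝ → Fin d → ℝ),
      p.IsSolution T C b ∧
      (∀ (C' : ℝ → Matrix (Fin d) (Fin d) ℝ) (b' : ℝ → Fin d → ℝ),
        p.IsSolution T C' b' → ∀ t ≤ T, C' t = C t ∧ b' t = b t) ∧
      (∃ tstar ≤ T, ∀ t < tstar, ∀ z : ℂ,
        Module.End.HasEigenvalue
          (Matrix.toLin' ((p.Rc (C t)).map (algebraMap ℝ ℂ))) z → 0 < z.re) ∧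
      (∃ bbar : Fin d → ℝ, Tendsto b atBot (𝓝 bbar)) := by
  have hκ := p.riskRatio_neg hgamma
  have hκ' := p.neg_one_lt_riskRatio hgamma
  have hS := p.sigma3_posSemidef
  have hM := p.neutralPrecision_posSemidef hSigma1 hbeta
  have hMSM := p.neutralPrecision_mul_sigma3_mul hSigma0 hSigma1 hbeta
  have hQ : p.quadCoeff.PosSemidef := posSemidef_riccati_quadratic hS hM hMSM hκ.le hκ'.le
  have hK : p.constCoeff.PosSemidef := by
    have h := (hM.conjTranspose_mul_mul_same p.deltaMat).smul
      (show (0 : ℝ) ≤ -(p.riskRatio / 2) by linarith)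
    rwa [conjTranspose_eq_transpose_of_trivial, CointegrationModel.deltaMat,
      diagonal_transpose] at h
  obtain ⟨P, X, hP0, hPX⟩ := exists_riccati_solution p.driftCoeff hQ hK
  have hPpsd := fun s hs => (hPX s hs).1
  have hP' := fun s hs => (hPX s hs).2.1
  obtain ⟨B, hB⟩ := exists_trace_le_of_riccati hQ (riccati_stabilizing_gain p.deltaMat hMSM hκ')
    hdelta hPpsd hP'
  obtain ⟨Pbar, hPbar⟩ := exists_tendsto_of_posSemidef_deriv hPpsd hP'
    (fun s hs => (hPX s hs).2.2.1) hB
  have hPbar0 := posSemidef_of_tendsto hPpsd hPbar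
  obtain ⟨L, hL, c, hc, hLc⟩ := exists_lyapunov_of_riccatiField_eq_zero hκ hdelta hS hM hQ rfl rfl
    rfl hPbar0 (riccatiField_eq_zero_of_tendsto hP' hPbar)
  set R : ℝ → Matrix (Fin d) (Fin d) ℝ := fun s => (p.driftCoeff + p.quadCoeff * P s)ᵀ with hR
  set Rbar := (p.driftCoeff + p.quadCoeff * Pbar)ᵀ with hRbar
  have hRc : ∀ s, 0 ≤ s → p.Rc (-P s) = R s := fun s hs =>
    CointegrationModel.Rc_neg hSigma0 hSigma1 (hPpsd s hs).transpose_eq hQ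
  obtain ⟨c', hc', hZR⟩ := exists_dissipative_inv_of_lyapunov (R := Rbar) hL hc
    (by rwa [hRbar, transpose_transpose])
  have hRlim : Tendsto R atTop (𝓝 Rbar) := by
    have hcont : Continuous fun P : Matrix (Fin d) (Fin d) ℝ =>
        (p.driftCoeff + p.quadCoeff * P)ᵀ := by fun_prop
    exact (hcont.tendsto Pbar).comp hPbar
  have hflim : Tendsto (fun s => p.forcing (-P s)) atTop (𝓝 (p.forcing (-Pbar))) :=
    (p.continuous_forcing.tendsto _).comp hPbar.neg
  have hfcont : ContinuousOn (fun s => p.forcing (-P s)) (Ici 0) := fun s hs =>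
    (p.continuous_forcing.continuousAt.comp (f := fun s => -P s) (ContinuousAt.neg
      (continuousAt_pi.2 fun i => continuousAt_pi.2 fun j =>
        (hasDerivAt_matrix_iff.1 (hP' s hs) i j).continuousAt))).continuousWithinAt
  obtain ⟨b, hb0, hb⟩ := exists_linear_solution (fun s hs => (hPX s hs).2.2.2.1)
    (fun s hs => (hPX s hs).2.2.2.2) hfcont
  obtain ⟨bbar, hbbar⟩ := exists_tendsto_of_dissipative hL.inv hc' hZR hRlim hflim hb
  have hsol : p.IsSolution T (fun t => -P (T - t)) (fun t => b (T - t)) := by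
    refine ⟨by simp [hP0], by simp [hb0], fun t ht i j => ?_, fun t ht i => ?_⟩
    · have h := hasDerivAt_matrix_iff.1 (hP' (T - t) (sub_nonneg.2 ht)) i j
      rw [p.riccatiRHS_neg hSigma0]
      have h2 := (h.comp_const_sub T t).neg
      rw [neg_neg] at h2
      exact h2.hasDerivWithinAt
    · have h := hasDerivAt_pi.1 (hb (T - t) (sub_nonneg.2 ht)) i
      have h2 := h.comp_const_sub T t
      rw [hRc _ (sub_nonneg.2 ht)]
      convert! h2.hasDerivWithinAt using 1
      simp only [Pi.add_apply, Pi.sub_apply, Pi.neg_apply, hR]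
      ring
  have htime : Tendsto (fun t : ℝ => T - t) atBot atTop :=
    tendsto_atTop_add_const_left _ T tendsto_neg_atBot_atTop
  refine ⟨_, _, hsol, fun C' b' h' t ht => hsol.eq h' ht, ?_, bbar, hbbar.comp htime⟩
  have hZRlim : Tendsto (fun s => L⁻¹ * R s) atTop (𝓝 (L⁻¹ * Rbar)) := by
    have hcont : Continuous fun B : Matrix (Fin d) (Fin d) ℝ => L⁻¹ * B := by fun_prop
    exact (hcont.tendsto Rbar).comp hRlim
  obtain ⟨s₀, hs₀⟩ := eventually_atTop.1 (eventually_dissipative hc' hZRlim hZR)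
  -- Past reversed time `s₀` dissipativity holds; the maximum with `0` keeps `t ≤ T`, where `P`
  -- solves the equation.
  refine ⟨T - max s₀ 0, by simp, fun t ht z hz => ?_⟩
  have hs : max s₀ 0 ≤ T - t := by linarith
  rw [hRc _ ((le_max_right _ _).trans hs)] at hz
  refine re_pos_of_dissipative hL.inv (fun e he => ?_) hz
  refine lt_of_lt_of_le (mul_pos (half_pos hc') ?_) (hs₀ _ ((le_max_left _ _).trans hs) e)
  exact lt_of_le_of_ne (Finset.sum_nonneg fun i _ => mul_self_nonneg _)
    fun h => he (dotProduct_self_eq_zero.1 h.symm)
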